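/- Let $\mathfrak{A}=(Q,\Sigma_I\times\Sigma_O,q_\iota,\delta,\Omega)$ be a deterministic (max-)parity automaton with $n$ states, finite non-empty alphabets $\Sigma_I,\Sigma_O$, and coloring $\Omega\colon Q\to\mathbb{N}$; let $C=\Omega(Q)$ and $c=|C|$. Put $\delta_{\mathcal T}((q,e),(a,b))=(q',\max\{e,\Omega(q')\})$ with $q'=\delta(q,(a,b))$, and $\delta_{\mathcal P}(S,a)=\{\delta_{\mathcal T}(x,(a,b))\mid x\in S,\ b\in\Sigma_O\}$ for $S\subseteq Q\times C$, extended to finite words over $\Sigma_I$ as $\delta^*_{\mathcal P}$. For non-empty $D\subseteq Q\times C$ and $w\in\Sigma_I^*$ let $r^D_w\colon D\to 2^{Q\times C}$, $r^D_w(q,e)=\delta^*_{\mathcal P}(\{(q,\Omega(q))\},w)$, and for $k>0$ let $\mathfrak{R}=\{r^D_w\mid w\in\Sigma_I^k,\ \emptyset\ne D\subseteq Q\times C\}$. In the game $\mathcal{G}_k$, in each round $i\in\mathbb{N}$ Player $I$ picks $r_i\in\mathfrak{R}$ with $\mathrm{dom}(r_0)=\{(q_\iota,\Omega(q_\iota))\}$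 and $\mathrm{dom}(r_i)=r_{i-1}(q_{i-1},c_{i-1})$ for $i>0$, and then Player $O$ picks $(q_i,c_i)\in\mathrm{dom}(r_i)$; Player $O$ wins a play iff $\limsup_i c_i$ is even. As an arena-based parity game, $\mathcal{G}_k$ has the vertices $\{v_\iota\}\cup\mathfrak{R}\times(Q\times C)$ of Player $I$, with initial vertex $v_\iota$, and the vertices $\mathfrak{R}$ of Player $O$; its edges are $v_\iota\to r$ if $\mathrm{dom}(r)=\{(q_\iota,\Omega(q_\iota))\}$, $(r,x)\to r'$ if $x\in\mathrm{dom}(r)$ and $\mathrm{dom}(r')=r(x)$, and $r\to(r,x)$ if $x\in\mathrm{dom}(r)$; the vertex $(r,(q,e))$ has color $e$ and all other vertices have color $\min C$. Claim: there are a (deterministic) algorithm and a constant $d$ such that the following holds for all such $\mathfrak{A}$ and all $k$ with $0<k\le 2^{n^2c+1}$. Given $\mathfrak{A}$ and $k$ (numbers written in binary, transitions as a table; let $\ell$ be the length of this input), the algorithm halts within $2^{d\,n^d}\cdot \ell^{d}$ steps and outputs a parity game $G$, with vertices numbered $0,\dots,N-1$, that is isomorphic to the arena-based parity game $\mathcal{G}_k$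 described above, together with a player $p$. Moreover, $N\le 2^{d\,n^d}$; the player $p$ has a winning strategy in $G$ from its initial vertex and the other player has none; and $p$ is Player $O$ if and only if Player $O$ has a winning strategy in $\mathcal{G}_k$. (Steps are counted for first-order functional programs over binary trees with unit-cost pairing, projection and emptiness test, a model polynomially equivalent to Turing machines.) -/

import Mathlib

namespace DelayGame

/-! ### Automata and the parity condition -/

/-- The parity condition: the largest number occurring infinitely often in `u` exists and is even.
For a bounded sequence this says that the limes superior of `u` is even. -/
def ParityAccepting (u : ℕ → ℕ) : Prop :=
  ∃ m, Even m ∧ (∃ᶠ i in Filter.atTop, u i = m) ∧ ∀ᶠ i in Filter.atTop, u i ≤ m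

/-- Deterministic parity automata with states `Q` and letters `S`; the automata that serve as inputs
below have finite `Q` and `S`. -/
structure DPA (Q S : Type*) where
  init : Q
  step : Q → S → Q
  color : Q → ℕ

namespace DPA

/-- The set `C = Ω(Q)` of colors, as a type. -/
abbrev Col {Q S : Type*} (𝔄 : DPA Q S) : Type := Set.range 𝔄.color

/-- The number of colors of the automaton. -/
noncomputable def numColors {Q S : Type*} (𝔄 : DPA Q S) : ℕ := (Set.range 𝔄.color).ncard

/-- The color of a state, as an element of `C`. -/
def colorOf {Q S : Type*} (𝔄 : DPA Q S) (q : Q) : 𝔄.Col := ⟨𝔄.color q, q, rfl⟩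

/-- The pairs `Q × C`. -/
abbrev Pos {Q S : Type*} (𝔄 : DPA Q S) : Type _ := Q × 𝔄.Col

/-- The transition function keeping track of the maximal color seen. -/
noncomputable def stepT {Q S : Type*} (𝔄 : DPA Q S) (x : 𝔄.Pos) (l : S) : 𝔄.Pos :=
  (𝔄.step x.1 l, max x.2 (𝔄.colorOf (𝔄.step x.1 l)))

/-- Projection to the first component of the letters and power set construction. -/
def stepP {Q I O : Type*} (𝔄 : DPA Q (I × O)) (X : Set 𝔄.Pos) (a : I) : Set 𝔄.Pos :=
  {y | ∃ x ∈ X, ∃ b : O, y = 𝔄.stepT x (a, b)}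

/-- The extension of `stepP` to finite words. -/
def stepPStar {Q I O : Type*} (𝔄 : DPA Q (I × O)) (X : Set 𝔄.Pos) (w : List I) : Set 𝔄.Pos :=
  w.foldl 𝔄.stepP X

/-- Partial functions from `Q × C` to the power set of `Q × C`. -/
abbrev PartialFun {Q S : Type*} (𝔄 : DPA Q S) : Type _ := 𝔄.Pos → Option (Set 𝔄.Pos)

/-- The domain of a partial function. -/
def dom {Q S : Type*} {𝔄 : DPA Q S} (r : 𝔄.PartialFun) : Set 𝔄.Pos := {x | (r x).isSome}

open Classical in
/-- The partial function `r_w^D` with domain `D`. -/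
noncomputable def behavior {Q I O : Type*} (𝔄 : DPA Q (I × O)) (D : Set 𝔄.Pos) (w : List I) :
    𝔄.PartialFun :=
  fun x => if x ∈ D then some (𝔄.stepPStar {(x.1, 𝔄.colorOf x.1)} w) else none

/-- The set of all `r_w^D` with a word `w` of length `k` and a non-empty `D`. -/
def behaviors {Q I O : Type*} (𝔄 : DPA Q (I × O)) (k : ℕ) : Set 𝔄.PartialFun :=
  {r | ∃ w : List I, ∃ D : Set 𝔄.Pos, w.length = k ∧ D.Nonempty ∧ r = 𝔄.behavior D w}

/-! ### The abstract game `𝒢_k`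

A play is a sequence of rounds; round `i` consists of the function `(ρ i).1` picked by Player `I`
and the pair `(ρ i).2` picked by Player `O`. -/

/-- The sequences of moves that obey the rules of the game. -/
structure IsPlay {Q I O : Type*} (𝔄 : DPA Q (I × O)) (k : ℕ)
    (ρ : ℕ → 𝔄.behaviors k × 𝔄.Pos) : Prop where
  /-- The first move of Player `I`. -/
  start : dom (ρ 0).1.1 = {(𝔄.init, 𝔄.colorOf 𝔄.init)}
  /-- The other moves of Player `I`: the domain of the new function is `r (q, c)`. -/
  next : ∀ i, (ρ i).1.1 (ρ i).2 = some (dom (ρ (i + 1)).1.1)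
  /-- The moves of Player `O`. -/
  answer : ∀ i, (ρ i).2 ∈ dom (ρ i).1.1

/-- Player `O` wins `𝒢_k`: she has a strategy `σ`, mapping the list of the previous rounds and the
current function `r` to an element of the domain of `r`, such that every play consistent with `σ`
satisfies the parity condition. -/
def OWins {Q I O : Type*} (𝔄 : DPA Q (I × O)) (k : ℕ) : Prop :=
  ∃ σ : List (𝔄.behaviors k × 𝔄.Pos) → 𝔄.behaviors k → 𝔄.Pos,
    (∀ h r, σ h r ∈ dom r.1) ∧
    ∀ ρ : ℕ → 𝔄.behaviors k × 𝔄.Pos, 𝔄.IsPlay k ρ →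
      (∀ i, (ρ i).2 = σ ((List.range i).map ρ) (ρ i).1) →
      ParityAccepting fun i => ((ρ i).2.2 : ℕ)

end DPA

/-! ### Arena-based parity games -/

inductive Player
  | I
  | O

/-- A parity game on a directed graph with an initial vertex. -/
structure ParityGame (V : Type*) where
  owner : V → Player
  edge : V → V → Prop
  init : V
  color : V → ℕ

namespace ParityGame

/-- The condition for an infinite play to be won by a player: Player `O` wins if the largest color
seen infinitely often is even, Player `I` wins all other plays. -/
def WinCond {V : Type*} (G : ParityGame V) (ρ : ℕ → V) : Player → Prop
  | .O => ParityAccepting fun i => G.color (ρ i)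
  | .I => ¬ ParityAccepting fun i => G.color (ρ i)

/-- The first `m` moves of `ρ` form a path from the initial vertex that is consistent with the
strategy `f` of player `p`. A strategy maps the history (which ends in the current vertex) to
the next vertex. -/
def Consistent {V : Type*} (G : ParityGame V) (p : Player) (f : List V → V) (ρ : ℕ → V) (m : ℕ) :
    Prop :=
  ρ 0 = G.init ∧ ∀ i < m, G.edge (ρ i) (ρ (i + 1)) ∧
    (G.owner (ρ i) = p → ρ (i + 1) = f ((List.range (i + 1)).map ρ))

/-- Player `p` has a winning strategy from the initial vertex: the strategy always provides a
legal move (so `p` never gets stuck, while a finite play in which the opponent gets stuck is won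
by `p`), and all infinite consistent plays are won by `p`. -/
def Wins {V : Type*} (G : ParityGame V) (p : Player) : Prop :=
  ∃ f : List V → V,
    (∀ ρ m, G.Consistent p f ρ m → G.owner (ρ m) = p →
      G.edge (ρ m) (f ((List.range (m + 1)).map ρ))) ∧
    ∀ ρ, (∀ m, G.Consistent p f ρ m) → G.WinCond ρ p

/-- `e` is an isomorphism of parity games. -/
structure IsIso {V W : Type*} (G : ParityGame V) (H : ParityGame W) (e : V ≃ W) : Prop where
  owner : ∀ v, H.owner (e v) = G.owner v
  edge : ∀ v v', H.edge (e v) (e v') ↔ G.edge v v'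
  init : e G.init = H.init
  color : ∀ v, H.color (e v) = G.color v

end ParityGame

namespace DPA

/-- The vertices of the arena for `𝒢_k`: a fresh initial vertex, the pairs of a function and an
element of `Q × C` (both of Player `I`), and the functions (of Player `O`). -/
inductive Vertex {Q I O : Type*} (𝔄 : DPA Q (I × O)) (k : ℕ)
  | start : Vertex 𝔄 k
  | pair (r : 𝔄.behaviors k) (x : 𝔄.Pos) : Vertex 𝔄 k
  | fn (r : 𝔄.behaviors k) : Vertex 𝔄 k

/-- `𝒢_k` as an arena-based parity game. -/
noncomputable def arena {Q I O : Type*} (𝔄 : DPA Q (I × O)) (k : ℕ) :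
    ParityGame (𝔄.Vertex k) where
  owner
    | .fn _ => .O
    | _ => .I
  edge
    | .start, .fn r => dom r.1 = {(𝔄.init, 𝔄.colorOf 𝔄.init)}
    | .pair r x, .fn r' => r.1 x = some (dom r'.1)
    | .fn r, .pair r' x => r' = r ∧ x ∈ dom r.1
    | _, _ => False
  init := .start
  color
    | .pair _ x => x.2
    | _ => sInf (Set.range 𝔄.color)

end DPA

/-! ### The model of computation

Programs of a first-order functional language with unary functions on binary trees (pure Lisp),
evaluated call by value. The primitives are constructing a pair, projecting, and testing for the
empty tree; there are no arithmetic operations and there is no equality test. The cost of an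
evaluation is the number of rules applied, each of which moves a bounded number of pointers, so
running times agree with those of Turing machines up to a polynomial. -/

inductive Tree
  | nil
  | node (l r : Tree)

namespace Tree

/-- The size of a tree (its number of nodes, leaves included). -/
def size : Tree → ℕ
  | nil => 1
  | node l r => l.size + r.size + 1

/-- The left component; that of the empty tree is the empty tree. -/
def left : Tree → Tree
  | nil => nil
  | node l _ => l

/-- The right component; that of the empty tree is the empty tree. -/
def right : Tree → Tree
  | nil => nil
  | node _ r => r

end Tree

/-- The expressions: the argument of the function that is being evaluated, the empty tree, pairs
and projections, a conditional testing for a non-empty tree, and a call of function number `f`. -/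
inductive Expr
  | arg
  | nil
  | cons (e₁ e₂ : Expr)
  | left (e : Expr)
  | right (e : Expr)
  | ite (e e₁ e₂ : Expr)
  | call (f : ℕ) (e : Expr)

/-- A program is a finite list of function bodies; function number `0` is the main function. -/
abbrev Program := List Expr

/-- `Eval P x e y t`: if the argument of the current function is `x`, then `e` evaluates to `y`
in exactly `t` steps. There is no rule for calls of functions missing in the program. -/
inductive Eval (P : Program) : Tree → Expr → Tree → ℕ → Prop
  | arg (x : Tree) : Eval P x .arg x 1
  | nil (x : Tree) : Eval P x .nil .nil 1
  | cons {x y₁ y₂ : Tree} {e₁ e₂ : Expr} {t₁ t₂ : ℕ} :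
      Eval P x e₁ y₁ t₁ → Eval P x e₂ y₂ t₂ → Eval P x (.cons e₁ e₂) (.node y₁ y₂) (t₁ + t₂ + 1)
  | left {x y : Tree} {e : Expr} {t : ℕ} :
      Eval P x e y t → Eval P x (.left e) y.left (t + 1)
  | right {x y : Tree} {e : Expr} {t : ℕ} :
      Eval P x e y t → Eval P x (.right e) y.right (t + 1)
  | ite_true {x l r y : Tree} {e e₁ e₂ : Expr} {t t₁ : ℕ} :
      Eval P x e (.node l r) t → Eval P x e₁ y t₁ → Eval P x (.ite e e₁ e₂) y (t + t₁ + 1)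
  | ite_false {x y : Tree} {e e₁ e₂ : Expr} {t t₂ : ℕ} :
      Eval P x e .nil t → Eval P x e₂ y t₂ → Eval P x (.ite e e₁ e₂) y (t + t₂ + 1)
  | call {x y z : Tree} {f : ℕ} {e b : Expr} {t t' : ℕ} :
      Eval P x e y t → P[f]? = some b → Eval P y b z t' → Eval P x (.call f e) z (t + t' + 1)

/-- The program `P` halts on input `x` with output `y` after `t` steps. -/
def Program.Outputs (P : Program) (x y : Tree) (t : ℕ) : Prop :=
  ∃ b, P[0]? = some b ∧ Eval P x b y t

/-! ### Encodings of inputs and outputs -/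

def encodeBool : Bool → Tree
  | false => .nil
  | true => .node .nil .nil

def encodeList {α : Type*} (f : α → Tree) : List α → Tree
  | [] => .nil
  | a :: l => .node (f a) (encodeList f l)

/-- Numbers are written in binary, least significant bit first. -/
def encodeNat (m : ℕ) : Tree := encodeList encodeBool m.bits

/-- The encoding of an automaton: the initial state, the table of all transitions, and the list
of the colors of the states. -/
def encodeDPA {n s t : ℕ} (𝔄 : DPA (Fin n) (Fin s × Fin t)) : Tree :=
  .node (encodeNat 𝔄.init)
    (.node
      (encodeList (encodeList (encodeList encodeNat)) (List.ofFn fun q => List.ofFn fun a =>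
        List.ofFn fun b => ((𝔄.step q (a, b) : Fin n) : ℕ)))
      (encodeList encodeNat (List.ofFn 𝔄.color)))

/-- The encoding of an automaton together with a number. -/
def encodeInput {n s t : ℕ} (𝔄 : DPA (Fin n) (Fin s × Fin t)) (k : ℕ) : Tree :=
  .node (encodeDPA 𝔄) (encodeNat k)

def encodePlayer : Player → Tree
  | .I => encodeBool false
  | .O => encodeBool true

open Classical in
/-- The encoding of a parity game with vertices `0, …, N - 1`: the initial vertex, the owners,
the colors, and the adjacency matrix. -/
noncomputable def encodeGame {N : ℕ} (G : ParityGame (Fin N)) : Tree :=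
  .node (encodeNat G.init)
    (.node (encodeList encodePlayer (List.ofFn G.owner))
      (.node (encodeList encodeNat (List.ofFn G.color))
        (encodeList (encodeList encodeBool)
          (List.ofFn fun v => List.ofFn fun v' => decide (G.edge v v')))))

/-- The encoding of a parity game together with a player. -/
noncomputable def encodeOutput {N : ℕ} (G : ParityGame (Fin N)) (p : Player) : Tree :=
  .node (encodeGame G) (encodePlayer p)

end DelayGame

namespace DelayGame

/-! ### Relocation of programs -/

/-! A word over the input alphabet enters the game only through the function from states to sets of
positions that it realizes. There are at most `2 ^ n ^ 3` such functions and at most `2 ^ n ^ 2`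
domains, whatever the alphabets and `k` are, so the arena has at most `2 ^ (5 * n ^ 3)` vertices
(`length_vertexList_le`). The functions realized by words of length `j + 1` depend only on those for
length `j`, so `k` rounds of a closure step with removal of duplicates find all of them
(`mem_layerAt`). Since `k ≤ 2 ^ (n ^ 2 * c + 1)`, that many rounds are affordable.

The arena has at most `n` colors, and its winner is found by evaluating a fixed point that is nested
once per color. With as many iterations at each level as there are vertices, this takes at most `(3
* N) ^ n` instructions for `N` vertices, which is exponential in `n ^ 4`. The stages of the
iterations provide progress measures, hence a positional winning strategy on the set computed
(`exists_certificate`). Complementing the set for one player gives the set for the other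
(`compl_solve`), so determinacy comes with the algorithm. The positional strategies are transported
to the numbered game by an isomorphism, and to the abstract game by inserting the vertices between
the rounds (`oWins_of_posWins`, `not_oWins_of_posWins`).

For the running time, every type carries a weight, and `Poly` consists of the functions computable
in time polynomial in the weight. It is closed under composition, conditionals and list recursion
with bounded intermediate values (`Poly.listRec`). The weight of an input contains the summand `2 ^
n ^ 4`, so the whole algorithm belongs to `Poly` (`poly_output`), and its program is assembled from
the closure properties. -/

/-- Add `d` to the numbers of all called functions. -/
def Expr.shift (d : ℕ) : Expr → Expr
  | .arg => .arg
  | .nil => .nil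
  | .cons a b => .cons (a.shift d) (b.shift d)
  | .left a => .left (a.shift d)
  | .right a => .right (a.shift d)
  | .ite a b c => .ite (a.shift d) (b.shift d) (c.shift d)
  | .call f a => .call (f + d) (a.shift d)

theorem Eval.shift {P Q : Program} {d : ℕ}
    (h : ∀ i b, P[i]? = some b → Q[i + d]? = some (b.shift d)) {x y : Tree} {e : Expr} {t : ℕ}
    (he : Eval P x e y t) : Eval Q x (e.shift d) y t := by
  induction he with
  | arg x => exact .arg x
  | nil x => exact .nil x
  | cons _ _ h₁ h₂ => exact .cons h₁ h₂
  | left _ h₁ => exact .left h₁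
  | right _ h₁ => exact .right h₁
  | ite_true _ _ h₁ h₂ => exact .ite_true h₁ h₂
  | ite_false _ _ h₁ h₂ => exact .ite_false h₁ h₂
  | call _ hb _ h₁ h₂ => exact .call h₁ (h _ _ hb) h₂

/-! ### Encoded types and polynomial-time functions -/

/-- Types whose elements are represented by trees. Running times are measured in terms of the
weight `wt`, which may exceed the size of the representation. -/
class Enc (α : Type) where
  enc : α → Tree
  wt : α → ℕ
  -- The strict inequality absorbs the additional node of a pair, so that the weights of components
  -- simply add up.
  size_lt_wt : ∀ a, (enc a).size < wt a

open Enc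

theorem Tree.one_le_size (x : Tree) : 1 ≤ x.size := by
  cases x <;> simp [Tree.size]

theorem two_le_wt {α : Type} [Enc α] (a : α) : 2 ≤ wt a :=
  lt_of_le_of_lt (Tree.one_le_size _) (size_lt_wt a)

instance : Enc Unit := ⟨fun _ => .nil, fun _ => 2, fun _ => by simp [Tree.size]⟩

instance : Enc Bool := ⟨encodeBool, fun b => (encodeBool b).size + 1, fun _ => by simp⟩

instance {α β : Type} [Enc α] [Enc β] : Enc (α × β) :=
  ⟨fun p => .node (enc p.1) (enc p.2), fun p => wt p.1 + wt p.2, fun p => by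
    have h1 := size_lt_wt p.1
    have h2 := size_lt_wt p.2
    simp only [Tree.size]; omega⟩

instance {α : Type} [Enc α] : Enc (List α) :=
  ⟨encodeList enc, fun l => 2 + (l.map wt).sum, fun l => by
    induction l with
    | nil => simp [encodeList, Tree.size]
    | cons a l ih =>
      have h := size_lt_wt a
      simp only [encodeList, Tree.size, List.map_cons, List.sum_cons]; omega⟩

/-- Natural numbers are represented in binary. -/
instance : Enc ℕ := ⟨encodeNat, fun m => (encodeNat m).size + 1, fun _ => by simp⟩

variable {α β γ σ : Type} [Enc α] [Enc β] [Enc γ] [Enc σ]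

@[simp] theorem wt_prod (a : α) (b : β) : wt (a, b) = wt a + wt b := rfl
@[simp] theorem wt_nil : wt ([] : List α) = 2 := rfl
@[simp] theorem wt_cons (a : α) (l : List α) : wt (a :: l) = wt a + wt l := by
  simp only [wt, List.map_cons, List.sum_cons]; omega
@[simp] theorem wt_unit (a : Unit) : wt a = 2 := rfl
theorem wt_bool_le (b : Bool) : wt b ≤ 4 := by cases b <;> decide
@[simp] theorem enc_prod (a : α) (b : β) : enc (a, b) = .node (enc a) (enc b) := rfl
@[simp] theorem enc_nil : enc ([] : List α) = .nil := rfl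
@[simp] theorem enc_cons (a : α) (l : List α) : enc (a :: l) = .node (enc a) (enc l) := rfl

theorem length_lt_wt (l : List α) : l.length < wt l := by
  induction l with
  | nil => simp
  | cons a l ih => have := two_le_wt a; simp; omega

theorem wt_le_of_mem {l : List α} {a : α} (h : a ∈ l) : wt a ≤ wt l := by
  induction l with
  | nil => simp at h
  | cons b l ih =>
    rcases List.mem_cons.1 h with rfl | h
    · simp
    · have := ih h; simp; omega

theorem wt_append (l l' : List α) : wt (l ++ l') + 2 = wt l + wt l' := by
  induction l with
  | nil => simp [add_comm]
  | cons a l ih => simp; omega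

theorem wt_le_of_sublist {l l' : List α} (h : l.Sublist l') : wt l ≤ wt l' := by
  induction h with
  | slnil => simp
  | cons a _ ih => simp; omega
  | cons_cons a _ ih => simp; omega

theorem wt_perm {l l' : List α} (h : l.Perm l') : wt l = wt l' := by
  simp only [wt, (h.map wt).sum_eq]

/-- This bounds results such as those of `nub` and `sortColors`, which need not be given as sublists
of their argument. -/
theorem wt_le_of_nodup {l l' : List α} (hl : l.Nodup) (h : l ⊆ l') : wt l ≤ wt l' := by
  obtain ⟨l'', h1, h2⟩ := List.subperm_of_subset hl h
  rw [← wt_perm h1]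
  exact wt_le_of_sublist h2

theorem wt_list_le {l : List α} {L M : ℕ} (hL : l.length ≤ L) (hM : ∀ a ∈ l, wt a ≤ M) :
    wt l ≤ 2 + L * M := by
  have : (l.map wt).sum ≤ l.length * M := by
    have := List.sum_le_card_nsmul (l.map wt) M (by simpa using hM)
    simpa using this
  have h2 := Nat.mul_le_mul_right M hL
  simp only [wt] at *; omega

/-- Bounds that are polynomial in the weight of the argument. -/
def PolyBd (h : α → ℕ) : Prop := ∃ c, ∀ a, h a ≤ wt a ^ c

theorem pow_wt_le (a : α) {c d : ℕ} (h : c ≤ d) : wt a ^ c ≤ wt a ^ d :=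
  Nat.pow_le_pow_right (by have := two_le_wt a; omega) h

theorem PolyBd.mono {h h' : α → ℕ} (hh : PolyBd h') (hle : ∀ a, h a ≤ h' a) : PolyBd h :=
  let ⟨c, hc⟩ := hh
  ⟨c, fun a => (hle a).trans (hc a)⟩

/-- Pure powers suffice as bounds: weights are at least `2`, so constants and sums are absorbed by a
larger exponent. -/
theorem PolyBd.const (m : ℕ) : PolyBd (fun _ : α => m) :=
  ⟨m, fun a => (Nat.lt_pow_self (two_le_wt a)).le⟩

theorem PolyBd.wt_self : PolyBd (fun a : α => wt a) := ⟨1, fun a => by simp⟩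

theorem PolyBd.mul {h h' : α → ℕ} (hh : PolyBd h) (hh' : PolyBd h') :
    PolyBd (fun a => h a * h' a) := by
  obtain ⟨c, hc⟩ := hh
  obtain ⟨c', hc'⟩ := hh'
  exact ⟨c + c', fun a => by rw [pow_add]; exact Nat.mul_le_mul (hc a) (hc' a)⟩

theorem PolyBd.add {h h' : α → ℕ} (hh : PolyBd h) (hh' : PolyBd h') :
    PolyBd (fun a => h a + h' a) := by
  obtain ⟨c, hc⟩ := hh
  obtain ⟨c', hc'⟩ := hh'
  refine ⟨c + c' + 1, fun a => ?_⟩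
  have h1 := (hc a).trans (pow_wt_le a (Nat.le_add_right c c'))
  have h2 := (hc' a).trans (pow_wt_le a (Nat.le_add_left c' c))
  have h3 := Nat.mul_le_mul_left (wt a ^ (c + c')) (two_le_wt a)
  show h a + h' a ≤ _
  rw [pow_succ]; omega

theorem PolyBd.pow {h : α → ℕ} (hh : PolyBd h) (m : ℕ) : PolyBd (fun a => h a ^ m) := by
  obtain ⟨c, hc⟩ := hh
  exact ⟨c * m, fun a => by rw [pow_mul]; exact Nat.pow_le_pow_left (hc a) m⟩

/-- The expression `e` of the program `P` computes `f`; the time and the weight of the result are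
bounded by `wt a ^ c`. -/
def Computes (P : Program) (e : Expr) (c : ℕ) (f : α → β) : Prop :=
  ∀ a, wt (f a) ≤ wt a ^ c ∧ ∃ t ≤ wt a ^ c, Eval P (enc a) e (enc (f a)) t

/-- Functions computable in polynomial time with results of polynomial weight. -/
@[fun_prop] def Poly (f : α → β) : Prop := ∃ P e c, Computes P e c f

theorem Poly.wt_bd {f : α → β} (hf : Poly f) : PolyBd (fun a => wt (f a)) :=
  let ⟨_, _, c, h⟩ := hf
  ⟨c, fun a => (h a).1⟩

/-- The program of a function can be placed at any position. -/
theorem Poly.place {f : α → β} (hf : Poly f) (d : ℕ) :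
    ∃ e P c, ∀ pre post : Program, pre.length = d → Computes (pre ++ (P ++ post)) e c f := by
  obtain ⟨P, e, c, h⟩ := hf
  refine ⟨e.shift d, P.map (Expr.shift d), c, fun pre post hd a => ⟨(h a).1, ?_⟩⟩
  obtain ⟨t, ht, he⟩ := (h a).2
  refine ⟨t, ht, he.shift fun i b hb => ?_⟩
  rw [List.getElem?_append_right (by omega), List.getElem?_append_left]
  · simp [hd, hb]
  · have := (List.getElem?_eq_some_iff.1 hb).1
    simp; omega

theorem Poly.of_bd {f : α → β} (P : Program) (e : Expr) {h : α → ℕ} (hh : PolyBd h)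
    (hw : PolyBd fun a => wt (f a)) (H : ∀ a, ∃ t ≤ h a, Eval P (enc a) e (enc (f a)) t) :
    Poly f := by
  obtain ⟨c, hc⟩ := hh
  obtain ⟨c', hc'⟩ := hw
  refine ⟨P, e, c + c', fun a => ⟨(hc' a).trans (pow_wt_le a (by omega)), ?_⟩⟩
  obtain ⟨t, ht, he⟩ := H a
  exact ⟨t, ht.trans ((hc a).trans (pow_wt_le a (by omega))), he⟩

@[fun_prop] theorem Poly.id : Poly (fun a : α => a) :=
  .of_bd [] .arg (.const 1) .wt_self fun _ => ⟨1, le_rfl, .arg _⟩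

/-- A mere change of view, such as reading a pair as a list with head and tail or an input as a
tuple of tables, costs one step. -/
theorem Poly.of_enc_eq {f : α → β} (h : ∀ a, enc (f a) = enc a) (hw : ∀ a, wt (f a) ≤ wt a) :
    Poly f :=
  .of_bd [] .arg (.const 1) (PolyBd.wt_self.mono hw) fun a => ⟨1, le_rfl, h a ▸ .arg _⟩

theorem exists_eval_const (x : Tree) : ∃ e t, ∀ (P : Program) (y : Tree), Eval P y e x t := by
  induction x with
  | nil => exact ⟨.nil, 1, fun _ y => .nil y⟩
  | node l r ihl ihr =>
    obtain ⟨e, t, h⟩ := ihl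
    obtain ⟨e', t', h'⟩ := ihr
    exact ⟨.cons e e', _, fun P y => .cons (h P y) (h' P y)⟩

@[fun_prop] theorem Poly.const (b : β) : Poly (fun _ : α => b) := by
  obtain ⟨e, t, h⟩ := exists_eval_const (enc b)
  exact .of_bd [] e (.const t) (.const (wt b)) fun _ => ⟨t, le_rfl, h _ _⟩

-- An expression sees only the argument of the current function, so feeding the result of `f` into
-- `g` takes a call: `g` becomes function `0` of the joint program. The weight bound for `f a`
-- yields the exponent `cf * cg`.
@[fun_prop] theorem Poly.comp {g : β → γ} {f : α → β} (hg : Poly g) (hf : Poly f) :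
    Poly (fun a => g (f a)) := by
  obtain ⟨eg, Pg, cg, hg⟩ := hg.place 1
  obtain ⟨ef, Pf, cf, hf⟩ := hf.place (1 + Pg.length)
  have hg := fun x => hg [eg] (Pf ++ []) rfl x
  have hf := fun x => hf ([eg] ++ Pg) [] (by simp [add_comm]) x
  refine .of_bd ([eg] ++ (Pg ++ (Pf ++ []))) (.call 0 ef)
    (h := fun a => wt a ^ cf + wt a ^ (cf * cg) + 1)
    (((PolyBd.wt_self.pow _).add (PolyBd.wt_self.pow _)).add (.const 1))
    (.mono (PolyBd.wt_self.pow (cf * cg)) fun a => ?_) fun a => ?_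
  · rw [pow_mul]
    exact (hg (f a)).1.trans (Nat.pow_le_pow_left (hf a).1 _)
  · obtain ⟨t, ht, h⟩ := (hf a).2
    obtain ⟨t', ht', h'⟩ := (hg (f a)).2
    refine ⟨t + t' + 1, ?_, .call (by simpa using h) rfl h'⟩
    have := ht'.trans (Nat.pow_le_pow_left (hf a).1 _)
    rw [← pow_mul] at this
    omega

@[fun_prop] theorem Poly.prodMk {f : α → β} {g : α → γ} (hf : Poly f) (hg : Poly g) :
    Poly (fun a => (f a, g a)) := by
  have hw := hf.wt_bd.add hg.wt_bd
  obtain ⟨eg, Pg, cg, hg⟩ := hg.place 0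
  obtain ⟨ef, Pf, cf, hf⟩ := hf.place Pg.length
  have hg := fun x => hg [] (Pf ++ []) rfl x
  have hf := fun x => hf Pg [] rfl x
  refine .of_bd (Pg ++ (Pf ++ [])) (.cons ef eg)
    (h := fun a => wt a ^ cf + wt a ^ cg + 1)
    (((PolyBd.wt_self.pow _).add (PolyBd.wt_self.pow _)).add (.const 1)) hw fun a => ?_
  obtain ⟨t, ht, h⟩ := (hf a).2
  obtain ⟨t', ht', h'⟩ := (hg a).2
  exact ⟨t + t' + 1, by omega, .cons h h'⟩

@[fun_prop] theorem Poly.fst : Poly (Prod.fst : α × β → α) :=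
  .of_bd [] (.left .arg) (.const 2) (PolyBd.wt_self.mono fun _ => Nat.le_add_right _ _)
    fun _ => ⟨2, le_rfl, .left (.arg _)⟩

@[fun_prop] theorem Poly.snd : Poly (Prod.snd : α × β → β) :=
  .of_bd [] (.right .arg) (.const 2) (PolyBd.wt_self.mono fun _ => Nat.le_add_left _ _)
    fun _ => ⟨2, le_rfl, .right (.arg _)⟩

@[fun_prop] theorem Poly.cons {f : α → β} {l : α → List β} (hf : Poly f) (hl : Poly l) :
    Poly (fun a => f a :: l a) := by
  have h : Poly (fun p : β × List β => p.1 :: p.2) :=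
    .of_enc_eq (fun _ => rfl) fun p => by simp only [wt_cons]; rfl
  exact h.comp (hf.prodMk hl)

@[fun_prop] theorem Poly.cond {b : α → Bool} {f g : α → β} (hb : Poly b) (hf : Poly f)
    (hg : Poly g) : Poly (fun a => bif b a then f a else g a) := by
  have hw := hf.wt_bd.add hg.wt_bd
  obtain ⟨eg, Pg, cg, hg⟩ := hg.place 0
  obtain ⟨ef, Pf, cf, hf⟩ := hf.place Pg.length
  obtain ⟨eb, Pb, cb, hb⟩ := hb.place (Pg.length + Pf.length)
  have hg := fun x => hg [] (Pf ++ (Pb ++ [])) rfl x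
  have hf := fun x => hf Pg (Pb ++ []) rfl x
  have hb := fun x => hb (Pg ++ Pf) [] (by simp) x
  simp only [List.append_assoc, List.nil_append] at hb hf hg
  refine .of_bd (Pg ++ (Pf ++ (Pb ++ []))) (.ite eb ef eg)
    (h := fun a => wt a ^ cf + wt a ^ cg + wt a ^ cb + 1)
    ((((PolyBd.wt_self.pow _).add (PolyBd.wt_self.pow _)).add (PolyBd.wt_self.pow _)).add
      (.const 1)) (hw.mono fun a => ?_) fun a => ?_
  · cases b a <;> simp
  obtain ⟨t, ht, h⟩ := (hf a).2
  obtain ⟨t', ht', h'⟩ := (hg a).2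
  obtain ⟨u, hu, h''⟩ := (hb a).2
  cases hba : b a <;> rw [hba] at h''
  · exact ⟨u + t' + 1, by omega, .ite_false h'' h'⟩
  · exact ⟨u + t + 1, by omega, .ite_true h'' h⟩

end DelayGame

/-! ### Bounded recursion along lists. -/

namespace DelayGame
open Enc
variable {α β γ σ δ : Type} [Enc α] [Enc β] [Enc γ] [Enc σ] [Enc δ]

theorem PolyBd.comp {h : β → ℕ} {f : α → β} (hh : PolyBd h) (hf : Poly f) :
    PolyBd fun a => h (f a) := by
  obtain ⟨c, hc⟩ := hh
  exact (hf.wt_bd.pow c).mono fun a => hc (f a)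

/-- Recursion along a list with a parameter. The relation `S` describes the arguments of the
recursive calls. -/
theorem Poly.listRec {R : α → List β → γ → σ} {l₀ : α → List β} {p₀ : α → γ}
    {B : α × γ → σ} {H : α × (β × (List β × γ)) → γ} {G : (α × (β × (List β × γ))) × σ → σ}
    (hl : Poly l₀) (hp : Poly p₀) (hB : Poly B) (hH : Poly H) (hG : Poly G)
    (hnil : ∀ a p, R a [] p = B (a, p))
    (hcons : ∀ a x l p, R a (x :: l) p = G ((a, (x, (l, p))), R a l (H (a, (x, (l, p))))))
    (S : α → List β → γ → Prop) (hS₀ : ∀ a, S a (l₀ a) (p₀ a))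
    (hS : ∀ a x l p, S a (x :: l) p → S a l (H (a, (x, (l, p)))))
    -- A uniform bound for all intermediate values has to be supplied: iterating a polynomially
    -- bounded step may lead to exponential growth.
    {W : α → ℕ} (hW : PolyBd W)
    (hbd : ∀ a l p, S a l p → wt l ≤ W a ∧ wt p ≤ W a ∧ wt (R a l p) ≤ W a) :
    Poly fun a => R a (l₀ a) (p₀ a) := by
  -- Rearranges the argument `(a, (x :: l, p))` as `(a, (x, (l, p)))`.
  set q : Expr := .cons (.left .arg) (.cons (.left (.left (.right .arg)))
    (.cons (.right (.left (.right .arg))) (.right (.right .arg)))) with hq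
  -- Function `0` is the recursion itself; functions `1`, `2` and `3` are `G`, `H` and `B`. Their
  -- auxiliary programs follow from position `4` on.
  set body : Expr := .ite (.left (.right .arg))
    (.call 1 (.cons q (.call 0 (.cons (.left .arg)
      (.cons (.right (.left (.right .arg))) (.call 2 q))))))
    (.call 3 (.cons (.left .arg) (.right (.right .arg)))) with hbody
  obtain ⟨eG, PG, cG, hG⟩ := hG.place 4
  obtain ⟨eH, PH, cH, hH⟩ := hH.place (4 + PG.length)
  obtain ⟨eB, PB, cB, hB⟩ := hB.place (4 + PG.length + PH.length)
  have hlw := hl.wt_bd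
  have hpw := hp.wt_bd
  obtain ⟨el, Pl, cl, hl⟩ := hl.place (4 + PG.length + PH.length + PB.length)
  obtain ⟨ep, Pp, cp, hp⟩ := hp.place (4 + PG.length + PH.length + PB.length + Pl.length)
  set Q : Program := [body, eG, eH, eB] ++ (PG ++ (PH ++ (PB ++ (Pl ++ (Pp ++ []))))) with hQ
  have hG : Computes Q eG cG G := hG [body, eG, eH, eB] _ rfl
  have hH : Computes Q eH cH H := by
    have := hH ([body, eG, eH, eB] ++ PG) (PB ++ (Pl ++ (Pp ++ []))) (by simp; omega)
    simpa only [List.append_assoc, hQ] using this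
  have hB : Computes Q eB cB B := by
    have := hB ([body, eG, eH, eB] ++ PG ++ PH) (Pl ++ (Pp ++ [])) (by simp; omega)
    simpa only [List.append_assoc, hQ] using this
  have hl : Computes Q el cl l₀ := by
    have := hl ([body, eG, eH, eB] ++ PG ++ PH ++ PB) (Pp ++ []) (by simp; omega)
    simpa only [List.append_assoc, hQ] using this
  have hp : Computes Q ep cp p₀ := by
    have := hp ([body, eG, eH, eB] ++ PG ++ PH ++ PB ++ Pl) [] (by simp; omega)
    simpa only [List.append_assoc, hQ] using this
  set M : α → ℕ := fun a => wt a + (W a + W a + W a + W a) with hM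
  have hMbd : PolyBd M := PolyBd.wt_self.add (((hW.add hW).add hW).add hW)
  -- The cost of one level of the recursion; the summand `50` covers the projections, pairs and
  -- calls.
  set K : α → ℕ := fun a => M a ^ cG + M a ^ cH + M a ^ cB + 50 with hK
  have hKbd : PolyBd K := (((hMbd.pow _).add (hMbd.pow _)).add (hMbd.pow _)).add (.const 50)
  have main : ∀ a l p, S a l p → ∃ t ≤ (l.length + 1) * K a,
      Eval Q (enc (a, (l, p))) body (enc (R a l p)) t := by
    intro a l
    induction l with
    | nil =>
      intro p hs
      obtain ⟨h1, h2, h3⟩ := hbd a _ p hs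
      obtain ⟨t, ht, h⟩ := (hB (a, p)).2
      have : t ≤ M a ^ cB := ht.trans (Nat.pow_le_pow_left (by simp [hM]; omega) _)
      rw [hnil]
      refine ⟨_, ?_, .ite_false (.left (.right (.arg _)))
        (.call (.cons (.left (.arg _)) (.right (.right (.arg _)))) rfl h)⟩
      simp only [hK, List.length_nil]
      omega
    | cons x l ih =>
      intro p hs
      have hs' := hS _ _ _ _ hs
      obtain ⟨h1, h2, h3⟩ := hbd a _ p hs
      obtain ⟨h1', h2', h3'⟩ := hbd a _ _ hs'
      obtain ⟨t, ht, h⟩ := (hH (a, (x, (l, p)))).2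
      obtain ⟨t', ht', h'⟩ := ih _ hs'
      obtain ⟨u, hu, h''⟩ := (hG ((a, (x, (l, p))), R a l (H (a, (x, (l, p)))))).2
      simp only [wt_cons] at h1
      have e1 : t ≤ M a ^ cH := ht.trans (Nat.pow_le_pow_left (by simp [hM]; omega) _)
      have e2 : u ≤ M a ^ cG := hu.trans (Nat.pow_le_pow_left (by simp [hM]; omega) _)
      have hqe : Eval Q (enc (a, (x :: l, p))) q (enc (a, (x, (l, p))))
          (2 + (4 + (4 + 3 + 1) + 1) + 1) :=
        .cons (.left (.arg _)) (.cons (.left (.left (.right (.arg _))))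
          (.cons (.right (.left (.right (.arg _)))) (.right (.right (.arg _)))))
      rw [hcons]
      refine ⟨_, ?_, .ite_true (.left (.right (.arg _)))
        (.call (.cons hqe (.call (.cons (.left (.arg _))
          (.cons (.right (.left (.right (.arg _)))) (.call hqe rfl h))) rfl h')) rfl h'')⟩
      simp only [List.length_cons]
      rw [Nat.succ_mul]
      simp only [hK] at *
      omega
  refine .of_bd Q (.call 0 (.cons .arg (.cons el ep)))
    (h := fun a => wt a ^ cl + wt a ^ cp + wt (l₀ a) * K a + 5)
    ((((PolyBd.wt_self.pow _).add (PolyBd.wt_self.pow _)).add (hlw.mul hKbd)).add (.const _))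
    (hW.mono fun a => (hbd a _ _ (hS₀ a)).2.2) fun a => ?_
  obtain ⟨t, ht, h⟩ := main a _ _ (hS₀ a)
  obtain ⟨t1, ht1, h1⟩ := (hl a).2
  obtain ⟨t2, ht2, h2⟩ := (hp a).2
  refine ⟨_, ?_, .call (.cons (.arg _) (.cons h1 h2)) rfl h⟩
  have := Nat.mul_le_mul_right (K a) (length_lt_wt (l₀ a))
  simp only [Nat.succ_eq_add_one] at this
  omega

theorem Poly.foldr {l : α → List β} {z : α → σ} {g : α → β → σ → σ}
    (hg : Poly fun q : α × (β × σ) => g q.1 q.2.1 q.2.2) (hz : Poly z) (hl : Poly l)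
    {W : α → ℕ} (hW : PolyBd W)
    (hbd : ∀ a l', l' <:+ l a → wt (l'.foldr (g a) (z a)) ≤ W a) :
    Poly fun a => (l a).foldr (g a) (z a) := by
  refine Poly.listRec (R := fun a l (_ : Unit) => l.foldr (g a) (z a)) (p₀ := fun _ => ())
    (B := fun q => z q.1) (H := fun _ => ()) (G := fun q => g q.1.1 q.1.2.1 q.2)
    hl (by fun_prop) (by fun_prop) (by fun_prop)
    (hg.comp (f := fun q : (α × (β × (List β × Unit))) × σ => (q.1.1, (q.1.2.1, q.2))) (by fun_prop))
    (fun _ _ => rfl) (fun _ _ _ _ => rfl)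
    (fun a l' _ => l' <:+ l a) (fun a => List.suffix_rfl)
    (fun a x l' _ h => (List.suffix_cons x l').trans h)
    (W := fun a => W a + wt (l a) + 2) ((hW.add hl.wt_bd).add (.const 2)) fun a l' p h => ?_
  have h1 := hbd a l' h
  have h2 := wt_le_of_sublist h.sublist
  exact ⟨by omega, by simp, by omega⟩

/-- The accumulator is the parameter of the recursion. At the remaining list `l'` it is the fold
over the prefix already consumed, so bounds for prefixes suffice. -/
theorem Poly.foldl {l : α → List β} {z : α → σ} {g : α → σ → β → σ}
    (hg : Poly fun q : α × (σ × β) => g q.1 q.2.1 q.2.2) (hz : Poly z) (hl : Poly l)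
    {W : α → ℕ} (hW : PolyBd W)
    (hbd : ∀ a l', l' <+: l a → wt (l'.foldl (g a) (z a)) ≤ W a) :
    Poly fun a => (l a).foldl (g a) (z a) := by
  refine Poly.listRec (R := fun a l p => l.foldl (g a) p) (p₀ := z)
    (B := fun q => q.2) (H := fun q => g q.1 q.2.2.2 q.2.1) (G := fun q => q.2)
    hl hz (by fun_prop)
    (hg.comp (f := fun q : α × (β × (List β × σ)) => (q.1, (q.2.2.2, q.2.1))) (by fun_prop))
    (by fun_prop) (fun _ _ => rfl) (fun _ _ _ _ => rfl)
    (fun a l' p => ∃ l₁, l a = l₁ ++ l' ∧ p = l₁.foldl (g a) (z a))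
    (fun a => ⟨[], rfl, rfl⟩)
    (fun a x l' p ⟨l₁, h, hp⟩ => ⟨l₁ ++ [x], by simp [h], by simp [hp]⟩)
    (W := fun a => W a + wt (l a)) (hW.add hl.wt_bd) fun a l' p ⟨l₁, h, hp⟩ => ?_
  have h2 : wt l' ≤ wt (l a) := wt_le_of_sublist (by rw [h]; exact List.sublist_append_right _ _)
  have h3 := hbd a l₁ ⟨l', h.symm⟩
  have h4 := hbd a (l₁ ++ l') (by rw [h])
  rw [hp, ← List.foldl_append]
  exact ⟨by omega, by omega, by omega⟩

/-- An element weighs no more than its list, so a single bound serves all elements. -/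
theorem PolyBd.elem {l : α → List β} {h : α × β → ℕ} (hl : Poly l) (hh : PolyBd h) :
    ∃ W : α → ℕ, PolyBd W ∧ ∀ a, ∀ x ∈ l a, h (a, x) ≤ W a := by
  obtain ⟨c, hc⟩ := hh
  refine ⟨fun a => (wt a + wt (l a)) ^ c, (PolyBd.wt_self.add hl.wt_bd).pow c, fun a x hx => ?_⟩
  exact (hc _).trans (Nat.pow_le_pow_left (Nat.add_le_add_left (wt_le_of_mem hx) _) _)

@[fun_prop] theorem Poly.map {l : α → List β} {g : α → β → γ}
    (hg : Poly fun q : α × β => g q.1 q.2) (hl : Poly l) :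
    Poly fun a => (l a).map (g a) := by
  simp only [List.map_eq_foldr]
  obtain ⟨W, hW, h⟩ := PolyBd.elem hl hg.wt_bd
  refine Poly.foldr (g := fun a x r => g a x :: r)
    (.cons (hg.comp (f := fun q : α × (β × List γ) => (q.1, q.2.1)) (by fun_prop)) (by fun_prop))
    (.const []) hl ((hl.wt_bd.mul hW).add (.const 2)) fun a l' hl' => ?_
  rw [← List.map_eq_foldr, add_comm]
  refine wt_list_le ?_ ?_
  · simpa using hl'.length_le.trans (length_lt_wt (l a)).le
  · simp only [List.mem_map]
    rintro _ ⟨x, hx, rfl⟩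
    exact h a x (hl'.subset hx)

@[fun_prop] theorem Poly.filter {l : α → List β} {g : α → β → Bool}
    (hg : Poly fun q : α × β => g q.1 q.2) (hl : Poly l) :
    Poly fun a => (l a).filter (g a) := by
  have : ∀ a, ∀ l' : List β, l'.filter (g a) =
      l'.foldr (fun x r => bif g a x then x :: r else r) [] := fun a l' => by
    induction l' with
    | nil => rfl
    | cons x l' ih => cases h : g a x <;> simp [h, ih]
  simp only [this]
  refine Poly.foldr (g := fun a x r => bif g a x then x :: r else r)
    (.cond (hg.comp (f := fun q : α × (β × List β) => (q.1, q.2.1)) (by fun_prop))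
      (by fun_prop) (by fun_prop))
    (.const []) hl hl.wt_bd fun a l' hl' => ?_
  rw [← this]
  exact wt_le_of_sublist (List.filter_sublist.trans hl'.sublist)

@[fun_prop] theorem Poly.append {l l' : α → List β} (hl : Poly l) (hl' : Poly l') :
    Poly fun a => l a ++ l' a := by
  have : ∀ l₁ l₂ : List β, l₁ ++ l₂ = l₁.foldr (fun x r => x :: r) l₂ := fun l₁ l₂ => by simp
  simp only [this]
  refine Poly.foldr (g := fun _ x r => x :: r) (by fun_prop) hl' hl
    (hl.wt_bd.add hl'.wt_bd) fun a l₁ h => ?_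
  rw [← this]
  have h1 := wt_append l₁ (l' a)
  have h2 := wt_le_of_sublist h.sublist
  omega

theorem wt_flatten (l : List (List β)) : wt l.flatten ≤ wt l := by
  induction l with
  | nil => simp
  | cons x l ih => have := wt_append x l.flatten; simp; omega

@[fun_prop] theorem Poly.flatten {l : α → List (List β)} (hl : Poly l) :
    Poly fun a => (l a).flatten := by
  have : ∀ l : List (List β), l.flatten = l.foldr (fun x r => x ++ r) [] := fun l => by
    induction l with
    | nil => rfl
    | cons x l ih => simp [ih]
  simp only [this]
  refine Poly.foldr (g := fun _ x r => x ++ r) (by fun_prop) (.const []) hl hl.wt_bd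
    fun a l₁ h => ?_
  rw [← this]
  exact (wt_flatten _).trans (wt_le_of_sublist h.sublist)

@[fun_prop] theorem Poly.flatMap {l : α → List β} {g : α → β → List γ}
    (hg : Poly fun q : α × β => g q.1 q.2) (hl : Poly l) :
    Poly fun a => (l a).flatMap (g a) := by
  simp only [List.flatMap_def]
  exact (Poly.map hg hl).flatten

theorem Poly.bool_foldr {l : α → List β} {z : α → Bool} {g : α → β → Bool → Bool}
    (hg : Poly fun q : α × (β × Bool) => g q.1 q.2.1 q.2.2) (hz : Poly z) (hl : Poly l) :
    Poly fun a => (l a).foldr (g a) (z a) :=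
  .foldr hg hz hl (.const 4) fun _ _ _ => wt_bool_le _

@[fun_prop] theorem Poly.and {f g : α → Bool} (hf : Poly f) (hg : Poly g) :
    Poly fun a => f a && g a := by
  have : ∀ b c : Bool, (b && c) = bif b then c else false := by decide
  simp only [this]; fun_prop

@[fun_prop] theorem Poly.or {f g : α → Bool} (hf : Poly f) (hg : Poly g) :
    Poly fun a => f a || g a := by
  have : ∀ b c : Bool, (b || c) = bif b then true else c := by decide
  simp only [this]; fun_prop

@[fun_prop] theorem Poly.not {f : α → Bool} (hf : Poly f) : Poly fun a => !(f a) := by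
  have : ∀ b : Bool, (!b) = bif b then false else true := by decide
  simp only [this]; fun_prop

@[fun_prop] theorem Poly.any {l : α → List β} {g : α → β → Bool}
    (hg : Poly fun q : α × β => g q.1 q.2) (hl : Poly l) :
    Poly fun a => (l a).any (g a) := by
  have : ∀ a (l : List β), l.any (g a) = l.foldr (fun x r => g a x || r) false := fun a l => by
    induction l with
    | nil => rfl
    | cons x l ih => simp [ih]
  simp only [this]
  exact .bool_foldr (.or (hg.comp (f := fun q : α × (β × Bool) => (q.1, q.2.1)) (by fun_prop))
    (by fun_prop)) (.const _) hl

@[fun_prop] theorem Poly.all {l : α → List β} {g : α → β → Bool}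
    (hg : Poly fun q : α × β => g q.1 q.2) (hl : Poly l) :
    Poly fun a => (l a).all (g a) := by
  simp only [List.all_eq_not_any_not]
  fun_prop

end DelayGame

/-! ### Exact and injective encodings, and the equality test. -/

namespace DelayGame
open Enc
variable {α β γ σ : Type} [Enc α] [Enc β] [Enc γ] [Enc σ]

/-- The weight is the size of the representation plus one. -/
class EncExact (α : Type) [Enc α] : Prop where
  wt_eq : ∀ a : α, wt a = (enc a).size + 1

instance : EncExact Bool := ⟨fun _ => rfl⟩
instance : EncExact ℕ := ⟨fun _ => rfl⟩
instance [EncExact α] [EncExact β] : EncExact (α × β) := ⟨fun p => by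
  have h1 := EncExact.wt_eq p.1
  have h2 := EncExact.wt_eq p.2
  change wt p.1 + wt p.2 = (enc p.1).size + (enc p.2).size + 1 + 1; omega⟩
instance [EncExact α] : EncExact (List α) := ⟨fun l => by
  induction l with
  | nil => rfl
  | cons a l ih =>
    have h := EncExact.wt_eq a
    simp only [wt_cons, enc_cons, Tree.size]; omega⟩

/-- Different elements have different representations. -/
class EncInj (α : Type) [Enc α] : Prop where
  inj : Function.Injective (enc : α → Tree)

theorem encodeBool_injective : Function.Injective encodeBool := by
  rintro (_ | _) (_ | _) h <;> simp_all [encodeBool]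

instance : EncInj Bool := ⟨encodeBool_injective⟩
instance [EncInj α] [EncInj β] : EncInj (α × β) := ⟨fun p q h => by
  simp only [enc, Tree.node.injEq] at h
  exact Prod.ext (EncInj.inj h.1) (EncInj.inj h.2)⟩
instance [EncInj α] : EncInj (List α) := ⟨fun l => by
  induction l with
  | nil => rintro (_ | _) h <;> simp_all
  | cons a l ih =>
    rintro (_ | ⟨b, l'⟩) h
    · simp at h
    · simp only [enc_cons, Tree.node.injEq] at h
      rw [EncInj.inj h.1, ih h.2]⟩
theorem bits_injective : Function.Injective Nat.bits := fun m k h =>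
  Nat.eq_of_testBit_eq fun i => by rw [Nat.testBit_eq_inth, Nat.testBit_eq_inth, h]

instance : EncInj ℕ := ⟨fun a b h => by
  have h' : (enc a.bits) = enc b.bits := h
  exact bits_injective (EncInj.inj h')⟩

/-- A number and the list of its bits are the same tree, and exactness makes their weights equal.
Arithmetic thus reduces to functions on lists. -/
theorem Poly.of_bits {f : α → ℕ} (hf : Poly fun a => (f a).bits) : Poly f := by
  obtain ⟨P, e, c, h⟩ := hf
  refine ⟨P, e, c, fun a => ?_⟩
  have h1 := (EncExact.wt_eq (f a).bits).symm.le
  exact ⟨h1.trans (h a).1, (h a).2⟩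

@[fun_prop] theorem Poly.bits {f : α → ℕ} (hf : Poly f) : Poly fun a => (f a).bits := by
  obtain ⟨P, e, c, h⟩ := hf
  refine ⟨P, e, c, fun a => ?_⟩
  have h1 := (EncExact.wt_eq (f a).bits).le
  exact ⟨h1.trans (h a).1, (h a).2⟩

/-- The body of a recursive equality test for the components of a pair. -/
def eqExpr : Expr :=
  .ite (.left .arg)
    (.ite (.right .arg)
      (.ite (.call 0 (.cons (.left (.left .arg)) (.left (.right .arg))))
        (.call 0 (.cons (.right (.left .arg)) (.right (.right .arg)))) .nil) .nil)
    (.ite (.right .arg) .nil (.cons .nil .nil))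

/-- Both trees are traversed in parallel, and the descent stops where either of them ends, so the
size of the first one alone bounds the time. -/
theorem exists_eval_eq (u v : Tree) : ∃ t ≤ 30 * u.size,
    ∃ r : Bool, (r = true ↔ u = v) ∧ Eval [eqExpr] (.node u v) eqExpr (encodeBool r) t := by
  induction u generalizing v with
  | nil =>
    have hl : Eval [eqExpr] (.node .nil v) (.left .arg) .nil 2 := .left (.arg _)
    have hr : Eval [eqExpr] (.node .nil v) (.right .arg) v 2 := .right (.arg _)
    cases v with
    | nil =>
      refine ⟨_, ?_, true, by simp, .ite_false hl (.ite_false hr (.cons (.nil _) (.nil _)))⟩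
      simp [Tree.size]
    | node v₁ v₂ =>
      refine ⟨_, ?_, false, by simp, .ite_false hl (.ite_true hr (.nil _))⟩
      simp [Tree.size]
  | node u₁ u₂ ih₁ ih₂ =>
    have hl : Eval [eqExpr] (.node (.node u₁ u₂) v) (.left .arg) (.node u₁ u₂) 2 := .left (.arg _)
    have hr : Eval [eqExpr] (.node (.node u₁ u₂) v) (.right .arg) v 2 := .right (.arg _)
    cases v with
    | nil =>
      refine ⟨_, ?_, false, by simp, .ite_true hl (.ite_false hr (.nil _))⟩
      simp [Tree.size]; omega
    | node v₁ v₂ =>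
      obtain ⟨t₁, ht₁, r₁, hr₁, e₁⟩ := ih₁ v₁
      obtain ⟨t₂, ht₂, r₂, hr₂, e₂⟩ := ih₂ v₂
      have c₁ : Eval [eqExpr] (.node (.node u₁ u₂) (.node v₁ v₂))
        (.cons (.left (.left .arg)) (.left (.right .arg))) (.node u₁ v₁) 7 :=
        .cons (.left hl) (.left hr)
      have c₂ : Eval [eqExpr] (.node (.node u₁ u₂) (.node v₁ v₂))
        (.cons (.right (.left .arg)) (.right (.right .arg))) (.node u₂ v₂) 7 :=
        .cons (.right hl) (.right hr)
      have e₁' := Eval.call c₁ (f := 0) rfl e₁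
      have e₂' := Eval.call c₂ (f := 0) rfl e₂
      by_cases h : u₁ = v₁
      · obtain rfl := hr₁.2 h
        refine ⟨_, ?_, r₂, by simp [hr₂, h], .ite_true hl (.ite_true hr (.ite_true e₁' e₂'))⟩
        simp only [Tree.size]; omega
      · obtain rfl : r₁ = false := by
          cases r₁ with
          | false => rfl
          | true => exact absurd (hr₁.1 rfl) h
        refine ⟨_, ?_, false, by simp [h], .ite_true hl (.ite_true hr (.ite_false e₁' (.nil _)))⟩
        simp only [Tree.size]; omega

@[fun_prop] theorem Poly.beq [EncInj β] [BEq β] [LawfulBEq β] {f g : α → β} (hf : Poly f)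
    (hg : Poly g) : Poly fun a => f a == g a := by
  have h : Poly fun p : β × β => p.1 == p.2 := by
    refine .of_bd [eqExpr] eqExpr (h := fun p => 30 * wt p) ((PolyBd.const 30).mul PolyBd.wt_self)
      (.mono (.const 4) fun _ => wt_bool_le _) fun p => ?_
    obtain ⟨t, ht, h⟩ := exists_eval_eq (enc p.1) (enc p.2)
    obtain ⟨r, hr, h⟩ := h
    refine ⟨t, ht.trans (Nat.mul_le_mul_left _ ?_), ?_⟩
    · have := size_lt_wt p.1
      obtain ⟨p1, p2⟩ := p
      simp at *; omega
    · have : r = (p.1 == p.2) := by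
        rw [Bool.eq_iff_iff, hr, beq_iff_eq, EncInj.inj.eq_iff]
      rw [this] at h
      exact h
  exact h.comp (hf.prodMk hg)

@[fun_prop] theorem Poly.tail {l : α → List β} (hl : Poly l) : Poly fun a => (l a).tail := by
  have h : Poly fun l : List β => l.tail :=
    .of_bd [] (.right .arg) (.const 2)
      (PolyBd.wt_self.mono fun l => wt_le_of_sublist (List.tail_sublist l))
      fun l => ⟨2, le_rfl, by cases l <;> exact .right (.arg _)⟩
  exact h.comp hl

@[fun_prop] theorem Poly.headD {l : α → List β} {d : α → β} (hl : Poly l) (hd : Poly d) :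
    Poly fun a => (l a).headD (d a) := by
  refine Poly.listRec (R := fun _ l d => l.headD d) (B := fun q => q.2) (H := fun q => q.2.2.2)
    (G := fun q => q.1.2.1) hl hd (by fun_prop) (by fun_prop) (by fun_prop) (fun _ _ => rfl)
    (fun _ _ _ _ => rfl) (fun a l' p => l' <:+ l a ∧ p = d a) (fun a => ⟨List.suffix_rfl, rfl⟩)
    (fun a x l' _ h => ⟨(List.suffix_cons x l').trans h.1, h.2⟩) (hl.wt_bd.add hd.wt_bd)
    fun a l' p h => ?_
  obtain ⟨h, rfl⟩ := h
  have h1 := wt_le_of_sublist h.sublist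
  refine ⟨by omega, by omega, ?_⟩
  cases l' with
  | nil => simp
  | cons x l' => simp at *; omega

/-! ### Binary numbers -/

/-- Binary successor. -/
def succBits : List Bool → List Bool
  | [] => [true]
  | b :: l => bif b then false :: succBits l else true :: l

theorem bits_eq_cons {m : ℕ} (h : m ≠ 0) : m.bits = m.bodd :: (m / 2).bits := by
  conv_lhs => rw [← Nat.bit_bodd_div2 m]
  rw [Nat.div2_val, Nat.bits_append_bit]
  intro h0
  have := Nat.bodd_add_div2 m
  rw [Nat.div2_val, h0] at this
  cases hb : m.bodd <;> simp_all

theorem bits_succ (m : ℕ) : (m + 1).bits = succBits m.bits := by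
  induction m using Nat.strong_induction_on with
  | _ m ih =>
    rcases eq_or_ne m 0 with rfl | h
    · simp [succBits]
    · rw [bits_eq_cons h, bits_eq_cons (Nat.succ_ne_zero m), succBits]
      have hm := Nat.bodd_add_div2 m
      rw [Nat.div2_val] at hm
      cases hb : m.bodd <;> simp [hb] at *
      · congr 1; omega
      · rw [← ih (m / 2) (by omega)]; congr 1; omega

theorem wt_succBits (l : List Bool) : wt (succBits l) ≤ wt l + 4 := by
  induction l with
  | nil => decide
  | cons b l ih =>
    have h0 : wt false = 2 := rfl
    have h1 : wt true = 4 := rfl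
    cases b <;> simp [succBits, h0, h1] <;> omega

theorem wt_succ (m : ℕ) : wt (m + 1) ≤ wt m + 4 := by
  have h1 := EncExact.wt_eq (m + 1).bits
  have h2 := EncExact.wt_eq m.bits
  have h3 := wt_succBits m.bits
  rw [← bits_succ] at h3
  have h4 : wt (m + 1) = (enc (m + 1).bits).size + 1 := rfl
  have h5 : wt m = (enc m.bits).size + 1 := rfl
  omega

theorem wt_nat_le (m : ℕ) : wt m ≤ 4 * m + 2 := by
  induction m with
  | zero => decide
  | succ m ih => have := wt_succ m; omega

@[fun_prop] theorem Poly.succ {f : α → ℕ} (hf : Poly f) : Poly fun a => f a + 1 := by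
  refine .of_bits ?_
  simp only [bits_succ]
  refine Poly.listRec (R := fun _ l (_ : Unit) => succBits l) (p₀ := fun _ => ())
    (B := fun _ => [true]) (H := fun _ => ())
    (G := fun q => bif q.1.2.1 then false :: q.2 else true :: q.1.2.2.1) hf.bits (by fun_prop)
    (by fun_prop) (by fun_prop) (by fun_prop) (fun _ _ => rfl) (fun _ _ _ _ => rfl)
    (fun a l' _ => l' <:+ (f a).bits) (fun a => List.suffix_rfl)
    (fun a x l' _ h => (List.suffix_cons x l').trans h) (hf.bits.wt_bd.add (.const 6))
    fun a l' p h => ?_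
  have h1 := wt_le_of_sublist h.sublist
  have h2 := wt_succBits l'
  exact ⟨by omega, by simp, by omega⟩

/-- Comparison of binary numbers. -/
def leBits : List Bool → List Bool → Bool
  | [], _ => true
  | b :: l, l' => bif l == l'.tail then (bif b then l'.headD false else true) else leBits l l'.tail

theorem bits_tail (m : ℕ) : m.bits.tail = (m / 2).bits := by
  rcases eq_or_ne m 0 with rfl | h
  · simp
  · rw [bits_eq_cons h]; rfl

theorem bits_headD (m : ℕ) : m.bits.headD false = m.bodd := by
  rcases eq_or_ne m 0 with rfl | h
  · simp
  · rw [bits_eq_cons h]; rfl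

/-- The halves decide unless they are equal, in which case the lowest bits do. Equality of the
halves may be tested on the lists because binary representations without leading zeros are unique.
-/
theorem ble_eq_leBits (m k : ℕ) : Nat.ble m k = leBits m.bits k.bits := by
  induction m using Nat.strong_induction_on generalizing k with
  | _ m ih =>
    rcases eq_or_ne m 0 with rfl | h
    · simp [leBits]
    · rw [bits_eq_cons h, leBits, bits_tail, bits_headD, ← ih _ (by omega), Bool.eq_iff_iff,
        Nat.ble_eq]
      have hm := Nat.bodd_add_div2 m
      have hk := Nat.bodd_add_div2 k
      rw [Nat.div2_val] at hm hk
      by_cases he : m / 2 = k / 2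
      · rw [he]
        cases hb : m.bodd <;> cases hb' : k.bodd <;> simp [hb, hb'] at * <;> omega
      · have : ((m / 2).bits == (k / 2).bits) = false := by
          simpa using fun h => he (bits_injective h)
        rw [this, cond_false, Nat.ble_eq]
        cases hb : m.bodd <;> cases hb' : k.bodd <;> simp [hb, hb'] at * <;> omega

@[fun_prop] theorem Poly.ble {f g : α → ℕ} (hf : Poly f) (hg : Poly g) :
    Poly fun a => Nat.ble (f a) (g a) := by
  simp only [ble_eq_leBits]
  refine Poly.listRec (R := fun _ l p => leBits l p) (B := fun _ => true)
    (H := fun q => q.2.2.2.tail)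
    (G := fun q => bif q.1.2.2.1 == q.1.2.2.2.tail then
      (bif q.1.2.1 then q.1.2.2.2.headD false else true) else q.2) hf.bits hg.bits
    (by fun_prop) (by fun_prop) (by fun_prop) (fun _ _ => rfl) (fun _ _ _ _ => rfl)
    (fun a l' p => l' <:+ (f a).bits ∧ p <:+ (g a).bits)
    (fun a => ⟨List.suffix_rfl, List.suffix_rfl⟩)
    (fun a x l' p h => ⟨(List.suffix_cons x l').trans h.1, (List.tail_suffix p).trans h.2⟩)
    ((hf.bits.wt_bd.add hg.bits.wt_bd).add (.const 4)) fun a l' p h => ?_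
  have h1 := wt_le_of_sublist h.1.sublist
  have h2 := wt_le_of_sublist h.2.sublist
  have h3 := wt_bool_le (leBits l' p)
  exact ⟨by omega, by omega, by omega⟩

@[fun_prop] theorem Poly.bodd {f : α → ℕ} (hf : Poly f) : Poly fun a => (f a).bodd := by
  simp only [← bits_headD]; fun_prop

/-- The value of a binary number in unary notation. -/
def unaryBits (l : List Bool) : List Unit :=
  l.foldr (fun b r => bif b then () :: (r ++ r) else r ++ r) []

theorem unaryBits_bits (m : ℕ) : unaryBits m.bits = List.replicate m () := by
  induction m using Nat.strong_induction_on with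
  | _ m ih =>
    rcases eq_or_ne m 0 with rfl | h
    · simp [unaryBits]
    · have hm := Nat.bodd_add_div2 m
      rw [Nat.div2_val] at hm
      have := ih (m / 2) (by omega)
      rw [bits_eq_cons h]
      simp only [unaryBits, List.foldr_cons] at this ⊢
      rw [this, List.eq_replicate_iff]
      cases hb : m.bodd <;> simp [hb] at * <;> omega

theorem length_unaryBits_le (l l' : List Bool) :
    (unaryBits l').length ≤ (unaryBits (l ++ l')).length := by
  induction l with
  | nil => simp
  | cons b l ih =>
    refine ih.trans ?_
    cases b <;> simp [unaryBits] <;> omega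

/-- Unary numbers serve as loop counters. The value itself has to be bounded, since it may be
exponential in the length of its binary representation. The partial results are the values of the
upper bits, which are no larger. -/
theorem Poly.replicate {k : α → ℕ} (hk : Poly k) (hb : PolyBd k) :
    Poly fun a => List.replicate (k a) () := by
  simp only [← unaryBits_bits]
  refine Poly.foldr (g := fun _ b r => bif b then () :: (r ++ r) else r ++ r) (by fun_prop)
    (.const []) hk.bits ((hb.mul (.const 2)).add (.const 2)) fun a l' ⟨l, h⟩ => ?_
  have h1 := length_unaryBits_le l l'
  rw [h, unaryBits_bits, List.length_replicate] at h1
  rw [add_comm]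
  exact wt_list_le h1 fun _ _ => le_rfl

/-! ### More functions on lists -/

/-- Remove duplicates. -/
def nub {β : Type} [BEq β] (l : List β) : List β :=
  l.foldr (fun x r => bif r.any (x == ·) then r else x :: r) []

omit [Enc β] in
theorem mem_nub [BEq β] [LawfulBEq β] {l : List β} {x : β} : x ∈ nub l ↔ x ∈ l := by
  induction l with
  | nil => rfl
  | cons y l ih =>
    have : nub (y :: l) = bif (nub l).any (y == ·) then nub l else y :: nub l := rfl
    rw [this]
    cases h : (nub l).any (y == ·)
    · simp [ih]
    · simp only [List.any_eq_true, beq_iff_eq] at h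
      obtain ⟨_, h, rfl⟩ := h
      rw [cond_true, List.mem_cons, ← ih]
      exact ⟨.inr, fun h' => h'.elim (fun h' => h' ▸ h) fun h' => h'⟩

omit [Enc β] in
theorem nodup_nub [BEq β] [LawfulBEq β] (l : List β) : (nub l).Nodup := by
  induction l with
  | nil => exact .nil
  | cons y l ih =>
    have : nub (y :: l) = bif (nub l).any (y == ·) then nub l else y :: nub l := rfl
    rw [this]
    cases h : (nub l).any (y == ·)
    · simp only [List.any_eq_false, beq_iff_eq] at h
      exact List.nodup_cons.2 ⟨fun h' => h _ h' rfl, ih⟩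
    · exact ih

@[fun_prop] theorem Poly.nub [EncInj β] [BEq β] [LawfulBEq β] {l : α → List β} (hl : Poly l) :
    Poly fun a => nub (l a) := by
  refine Poly.foldr (g := fun _ x r => bif r.any (x == ·) then r else x :: r) (by fun_prop)
    (.const []) hl hl.wt_bd fun a l' h => ?_
  exact wt_le_of_nodup (nodup_nub l') fun x hx => h.subset (mem_nub.1 hx)

omit [Enc β] in
theorem foldl_zipIdx (l : List β) (r : List (β × ℕ)) (m : ℕ) :
    l.foldl (fun (p : List (β × ℕ) × ℕ) x => (p.1 ++ [(x, p.2)], p.2 + 1)) (r, m) =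
      (r ++ l.zipIdx m, m + l.length) := by
  induction l generalizing r m with
  | nil => simp
  | cons x l ih => simp [ih, List.zipIdx_cons]; omega

@[fun_prop] theorem Poly.zipIdx {l : α → List β} (hl : Poly l) : Poly fun a => (l a).zipIdx := by
  have : ∀ l : List β, l.zipIdx =
      (l.foldl (fun (p : List (β × ℕ) × ℕ) x => (p.1 ++ [(x, p.2)], p.2 + 1)) ([], 0)).1 :=
    fun l => by rw [foldl_zipIdx]; rfl
  simp only [this]
  refine .comp .fst (Poly.foldl
    (g := fun _ (p : List (β × ℕ) × ℕ) x => (p.1 ++ [(x, p.2)], p.2 + 1))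
    (by fun_prop) (.const _) hl
    (W := fun a => 2 + wt (l a) * (wt (l a) + (4 * wt (l a) + 2)) + (4 * wt (l a) + 2)) ?_
    fun a l' h => ?_)
  · have := hl.wt_bd
    have h4 := ((PolyBd.const 4).mul this).add (.const 2)
    exact ((PolyBd.const 2).add (this.mul (this.add h4))).add h4
  · rw [foldl_zipIdx]
    have h1 := wt_le_of_sublist h.sublist
    have h2 := length_lt_wt l'
    have h3 : wt (l'.zipIdx) ≤ 2 + wt (l a) * (wt (l a) + (4 * wt (l a) + 2)) := by
      refine wt_list_le (by simp; omega) ?_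
      rintro ⟨x, i⟩ hx
      have h4 := List.mem_zipIdx hx
      have h5 : wt x ≤ wt l' := wt_le_of_mem (h4.2.2 ▸ List.getElem_mem _)
      have h6 := wt_nat_le i
      simp only [wt_prod]; omega
    have h7 := wt_nat_le (0 + l'.length)
    simp only [wt_prod, List.nil_append]; omega

/-- Each sublist is light, so only their number needs a hypothesis. -/
theorem Poly.sublists' {l : α → List β} (hl : Poly l) (hb : PolyBd fun a => 2 ^ (l a).length) :
    Poly fun a => (l a).sublists' := by
  have : ∀ l : List β, l.sublists' = l.foldr (fun x r => r ++ r.map (fun s => x :: s)) [[]] :=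
    fun l => by
      induction l with
      | nil => rfl
      | cons x l ih => rw [List.sublists'_cons, ih]; rfl
  simp only [this]
  refine Poly.foldr (g := fun _ x (r : List (List β)) => r ++ r.map (fun s => x :: s)) (by fun_prop)
    (.const _) hl ((PolyBd.const 2).add (hb.mul hl.wt_bd)) fun a l' h => ?_
  rw [← this]
  refine wt_list_le ?_ fun s hs => ?_
  · rw [List.length_sublists']
    exact Nat.pow_le_pow_right (by omega) h.length_le
  · exact wt_le_of_sublist ((List.mem_sublists'.1 hs).trans h.sublist)

end DelayGame

namespace DelayGame

/-! ### Solving parity games by nested fixed points -/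

namespace ParityGame

variable {V : Type*} (G : ParityGame V)

/-- The colors that are good for player `p`. -/
def Good (p : Player) (c : ℕ) : Prop := Even c ↔ p = .O

/-- The vertices from which player `p` can force the next vertex to be in `X`. -/
def pre (p : Player) (X : Set V) : Set V :=
  {v | (G.owner v = p → ∃ u, G.edge v u ∧ u ∈ X) ∧ (G.owner v ≠ p → ∀ u, G.edge v u → u ∈ X)}

/-- The nested fixed point for the colors in a list; vertices of a color `c` not in the list have
to be left for `Z c`. The fixed points are approximated by `N` iterations. -/
noncomputable def solve (p : Player) (N : ℕ) : List ℕ → (ℕ → Set V) → Set V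
  | [], Z => {v | v ∈ G.pre p (Z (G.color v))}
  -- The start set is everything for a good color and empty for a bad one: the iteration
  -- approximates a greatest or a least fixed point, respectively. The head of the list is the
  -- outermost level.
  | c :: cs, Z => (fun X => solve p N cs (Function.update Z c X))^[N]
      {_v | Good p c}

variable {G}

theorem pre_mono {p : Player} {X Y : Set V} (h : X ⊆ Y) : G.pre p X ⊆ G.pre p Y :=
  fun _ hv => ⟨fun ho => (hv.1 ho).imp fun _ hu => ⟨hu.1, h hu.2⟩,
    fun ho u hu => h (hv.2 ho u hu)⟩

theorem update_mono {Z Z' : ℕ → Set V} (h : Z ≤ Z') (c : ℕ) {X Y : Set V} (hX : X ⊆ Y) :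
    Function.update Z c X ≤ Function.update Z' c Y := by
  intro d
  by_cases hd : d = c
  · subst hd; simpa using hX
  · simpa [Function.update_of_ne hd] using h d

theorem solve_mono {p : Player} {N : ℕ} {cs : List ℕ} :
    Monotone (G.solve p N cs) := by
  induction cs with
  | nil => exact fun Z Z' h v hv => pre_mono (h _) hv
  | cons c cs ih =>
    intro Z Z' h
    simp only [solve]
    generalize {_v : V | Good p c} = X₀
    have : ∀ j, (fun X => solve G p N cs (Function.update Z c X))^[j] X₀ ⊆
        (fun X => solve G p N cs (Function.update Z' c X))^[j] X₀ := fun j => by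
      induction j with
      | zero => exact subset_rfl
      | succ j ihj =>
        rw [Function.iterate_succ_apply', Function.iterate_succ_apply']
        exact ih (update_mono h c ihj)
    exact this N

/-- The sets for the colors in `cs` are overwritten before they are used, so the algorithm may leave
arbitrary values there. -/
theorem solve_congr {p : Player} {N : ℕ} {cs : List ℕ} {Z Z' : ℕ → Set V}
    (h : ∀ c, c ∉ cs → Z c = Z' c) : G.solve p N cs Z = G.solve p N cs Z' := by
  induction cs generalizing Z Z' with
  | nil => rw [funext fun c => h c (by simp)]
  | cons c cs ih =>
    simp only [solve]
    congr 1
    funext X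
    refine ih fun d hd => ?_
    by_cases hdc : d = c
    · subst hdc; simp
    · rw [Function.update_of_ne hdc, Function.update_of_ne hdc]
      exact h d (by simp [hd, hdc])

/-- The opponent. -/
def _root_.DelayGame.Player.other : Player → Player
  | .I => .O
  | .O => .I

theorem compl_pre (p : Player) (X : Set V) : (G.pre p X)ᶜ = G.pre p.other Xᶜ := by
  ext v
  have h : G.owner v = p.other ↔ G.owner v ≠ p := by
    cases p <;> cases G.owner v <;> simp [Player.other]
  simp only [pre, Set.mem_compl_iff, Set.mem_ofPred_eq, h, ne_eq, not_not]
  by_cases ho : G.owner v = p <;> simp [ho]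

theorem good_other (p : Player) (c : ℕ) : Good p.other c ↔ ¬ Good p c := by
  cases p <;> simp [Good, Player.other]

/-- Complementation exchanges the players, the two kinds of start sets, and hence all stages of the
iterations. This holds for every `N`, whether or not a fixed point has been reached. -/
theorem compl_solve (p : Player) (N : ℕ) (cs : List ℕ) (Z : ℕ → Set V) :
    (G.solve p N cs Z)ᶜ = G.solve p.other N cs (fun c => (Z c)ᶜ) := by
  induction cs generalizing Z with
  | nil =>
    ext v
    change v ∈ (G.pre p (Z (G.color v)))ᶜ ↔ _
    rw [compl_pre]; rfl
  | cons c cs ih =>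
    simp only [solve]
    have h0 : {_v : V | Good p c}ᶜ = {_v : V | Good p.other c} := by
      ext; simp [good_other]
    rw [← h0]
    generalize {_v : V | Good p c} = X₀
    have : ∀ j, ((fun X => solve G p N cs (Function.update Z c X))^[j] X₀)ᶜ =
        (fun X => solve G p.other N cs (Function.update (fun c => (Z c)ᶜ) c X))^[j] X₀ᶜ :=
      fun j => by
        induction j with
        | zero => rfl
        | succ j ihj =>
          rw [Function.iterate_succ_apply', Function.iterate_succ_apply', ih, ← ihj]
          congr 1
          funext d
          by_cases hd : d = c
          · subst hd; simp
          · simp [Function.update_of_ne hd]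
    exact this N

/-! ### Progress measures and positional strategies. -/

/-- The move from `v` to `u` makes progress: if the color of `v` is not in `cs`, it leads to `Z c`,
otherwise it stays in `W`, does not increase the measures of larger colors, and decreases the
measure of the color of `v` unless this color is good. -/
def Progress (G : ParityGame V) (p : Player) (cs : List ℕ) (Z : ℕ → Set V) (W : Set V)
    (μ : ℕ → V → ℕ) (v u : V) : Prop :=
  (G.color v ∉ cs → u ∈ Z (G.color v)) ∧
  (G.color v ∈ cs → u ∈ W ∧ (∀ c ∈ cs, G.color v ≤ c → μ c u ≤ μ c v) ∧
    (¬ Good p (G.color v) → μ (G.color v) u < μ (G.color v) v))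

/-- All moves from `W` that follow the strategy `g` of player `p` make progress. -/
def Certificate (G : ParityGame V) (p : Player) (cs : List ℕ) (Z : ℕ → Set V) (W : Set V)
    (g : V → V) (μ : ℕ → V → ℕ) : Prop :=
  ∀ v ∈ W, (G.owner v = p → G.edge v (g v) ∧ Progress G p cs Z W μ v (g v)) ∧
    (G.owner v ≠ p → ∀ u, G.edge v u → Progress G p cs Z W μ v u)

/-- The transfer is made one vertex at a time, because at a bad color the certificate that is used
varies with the rank of the vertex. -/
theorem Certificate.imp {p : Player} {cs cs' : List ℕ} {Z Z' : ℕ → Set V} {W W' : Set V}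
    {g g' : V → V} {μ μ' : ℕ → V → ℕ} {v : V}
    (h : (G.owner v = p → G.edge v (g v) ∧ Progress G p cs Z W μ v (g v)) ∧
      (G.owner v ≠ p → ∀ u, G.edge v u → Progress G p cs Z W μ v u)) (hg : g' v = g v)
    (H : ∀ u, Progress G p cs Z W μ v u → Progress G p cs' Z' W' μ' v u) :
    (G.owner v = p → G.edge v (g' v) ∧ Progress G p cs' Z' W' μ' v (g' v)) ∧
      (G.owner v ≠ p → ∀ u, G.edge v u → Progress G p cs' Z' W' μ' v u) := by
  rw [hg]
  exact ⟨fun ho => (h.1 ho).imp_right (H _), fun ho u hu => H _ (h.2 ho u hu)⟩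

/-- If the decreasing chain were not stable after `N` steps, its first `N + 1` inclusions would all
be strict, which needs more than `N` vertices. -/
theorem iterate_fixed [Fintype V] {f : Set V → Set V} (hf : Monotone f) {N : ℕ}
    (hN : Fintype.card V ≤ N) : f (f^[N] Set.univ) = f^[N] Set.univ := by
  have hanti : Antitone fun j => f^[j] Set.univ :=
    hf.antitone_iterate_of_map_le (Set.subset_univ _)
  by_contra hne
  have hlt : ∀ j ≤ N, f^[j + 1] Set.univ ⊂ f^[j] Set.univ := fun j hj => by
    refine lt_of_le_of_ne (hanti (Nat.le_succ j)) fun h => hne ?_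
    obtain ⟨i, rfl⟩ := Nat.exists_eq_add_of_le' hj
    calc f (f^[i + j] Set.univ) = f^[i + (j + 1)] Set.univ :=
          (Function.iterate_succ_apply' f (i + j) _).symm
      _ = f^[i] (f^[j + 1] Set.univ) := Function.iterate_add_apply ..
      _ = f^[i] (f^[j] Set.univ) := by rw [h]
      _ = f^[i + j] Set.univ := (Function.iterate_add_apply ..).symm
  have hcard : ∀ j ≤ N + 1, (f^[j] Set.univ).ncard + j ≤ Fintype.card V := fun j => by
    induction j with
    | zero => intro _; simp [Set.ncard_univ]
    | succ j ih =>
      intro hj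
      have := Set.ncard_lt_ncard (hlt j (by omega)) (Set.toFinite _)
      have := ih (by omega)
      omega
  have := hcard (N + 1) le_rfl
  omega

/-- Induction from the innermost color outwards. For a good outermost color `i` the result is a true
fixed point, so the inner certificate relative to it already works, with measure `0` for `i`. For a
bad one, a vertex follows the inner certificate of the first stage that contains it. The number of
that stage is the measure for `i`, and the inner measures are ordered lexicographically below it.
Since `i` exceeds all colors in `cs`, a move from color `i` need not respect their measures. -/
theorem exists_certificate [Fintype V] {p : Player} {N : ℕ} (hN : Fintype.card V ≤ N)
    (cs : List ℕ) (hcs : cs.Pairwise (· > ·)) (Z : ℕ → Set V) :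
    ∃ g μ, Certificate G p cs Z (G.solve p N cs Z) g μ := by
  classical
  induction cs generalizing Z with
  | nil =>
    refine ⟨fun v => if h : ∃ u, G.edge v u ∧ u ∈ Z (G.color v) then h.choose else v,
      fun _ _ => 0, fun v hv => ⟨fun ho => ?_, fun ho u hu => ?_⟩⟩
    · have h := hv.1 ho
      simp only [dif_pos h]
      exact ⟨h.choose_spec.1, fun _ => h.choose_spec.2, fun h => by simp at h⟩
    · exact ⟨fun _ => hv.2 ho u hu, fun h => by simp at h⟩
  | cons i cs ih =>
    rw [List.pairwise_cons] at hcs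
    have hi : i ∉ cs := fun h => lt_irrefl _ (hcs.1 i h)
    set f : Set V → Set V := fun X => G.solve p N cs (Function.update Z i X) with hf
    have hfm : Monotone f := fun X Y h => solve_mono (update_mono le_rfl i h)
    by_cases hgood : Good p i
    · have hW : G.solve p N (i :: cs) Z = f^[N] Set.univ := by simp [solve, hgood, hf]
      rw [hW]
      set X := f^[N] Set.univ with hX
      have hfix : G.solve p N cs (Function.update Z i X) = X := iterate_fixed hfm hN
      obtain ⟨g, μ, h⟩ := ih hcs.2 (Function.update Z i X)
      rw [hfix] at h
      refine ⟨g, fun c v => if c = i then 0 else μ c v, fun v hv =>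
        Certificate.imp (h v hv) rfl fun u hu => ⟨fun hc => ?_, fun hc => ?_⟩⟩
      · simp only [List.mem_cons, not_or] at hc
        have := hu.1 hc.2
        rwa [Function.update_of_ne hc.1] at this
      · by_cases hci : G.color v = i
        · have := hu.1 (hci ▸ hi)
          rw [hci, Function.update_self] at this
          refine ⟨this, fun c hc' hle => ?_, fun hb => absurd (hci ▸ hgood) hb⟩
          have : c = i := by
            rcases List.mem_cons.1 hc' with h | h
            · exact h
            · have := hcs.1 c h; omega
          simp [this]
        · obtain ⟨h1, h2, h3⟩ := hu.2 ((List.mem_cons.1 hc).resolve_left hci)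
          refine ⟨h1, fun c hc' hle => ?_, fun hb => by simpa [hci] using h3 hb⟩
          by_cases hc'' : c = i
          · simp [hc'']
          · simpa [hc''] using h2 c ((List.mem_cons.1 hc').resolve_left hc'') hle
    · have hW : G.solve p N (i :: cs) Z = f^[N] ∅ := by simp [solve, hgood, hf]
      rw [hW]
      have hmono : Monotone fun j => f^[j] ∅ :=
        hfm.monotone_iterate_of_le_map (Set.empty_subset _)
      choose g μ h using fun j : ℕ => ih hcs.2 (Function.update Z i (f^[j] ∅))
      replace h : ∀ j, Certificate G p cs (Function.update Z i (f^[j] ∅)) (f^[j + 1] ∅) (g j)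
          (μ j) := fun j => by
        rw [Function.iterate_succ_apply']; exact h j
      set rank : V → ℕ := fun v => sInf {j | v ∈ f^[j + 1] ∅} with hrank
      have hrank_le : ∀ {v j}, v ∈ f^[j + 1] ∅ → rank v ≤ j := fun hv => Nat.sInf_le hv
      -- `B` exceeds all inner measures, so `rank * B + μ` encodes the lexicographic order: a drop
      -- of the rank outweighs any change of `μ`.
      obtain ⟨B, hB⟩ : ∃ B, ∀ j < N, ∀ c ∈ cs, ∀ v, μ j c v < B := by
        refine ⟨((Finset.range N ×ˢ cs.toFinset ×ˢ (Finset.univ : Finset V)).sup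
          fun x => μ x.1 x.2.1 x.2.2) + 1, fun j hj c hc v => Nat.lt_succ_of_le ?_⟩
        exact Finset.le_sup (f := fun x : ℕ × ℕ × V => μ x.1 x.2.1 x.2.2) (b := (j, c, v))
          (by simp [hj, hc])
      refine ⟨fun v => g (rank v) v,
        fun c v => if c = i then rank v else rank v * B + μ (rank v) c v, fun v hv => ?_⟩
      obtain ⟨N', rfl⟩ : ∃ N', N = N' + 1 := by
        cases N with
        | zero => simp at hv
        | succ N' => exact ⟨N', rfl⟩
      have hvr : v ∈ f^[rank v + 1] ∅ := Nat.sInf_mem (s := {j | v ∈ f^[j + 1] ∅}) ⟨N', hv⟩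
      have hrN : rank v ≤ N' := hrank_le hv
      refine Certificate.imp (h (rank v) v hvr) rfl fun u hu => ⟨fun hc => ?_, fun hc => ?_⟩
      · simp only [List.mem_cons, not_or] at hc
        have := hu.1 hc.2
        rwa [Function.update_of_ne hc.1] at this
      · by_cases hci : G.color v = i
        · have := hu.1 (hci ▸ hi)
          rw [hci, Function.update_self] at this
          -- A move from a vertex of color `i` leads into the previous stage; from rank `0` it would
          -- lead into the empty set.
          have hlt : rank u < rank v := by
            rcases hr : rank v with _ | r
            · rw [hr] at this; simp at this
            · rw [hr] at this
              exact Nat.lt_succ_of_le (hrank_le this)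
          refine ⟨hmono (by omega) this, fun c hc' hle => ?_, fun _ => by simpa [hci] using hlt⟩
          have : c = i := by
            rcases List.mem_cons.1 hc' with h | h
            · exact h
            · have := hcs.1 c h; omega
          simpa [this] using hlt.le
        · obtain ⟨h1, h2, h3⟩ := hu.2 ((List.mem_cons.1 hc).resolve_left hci)
          have hle := hrank_le h1
          have key : ∀ c ∈ cs, rank u < rank v →
              rank u * B + μ (rank u) c u < rank v * B + μ (rank v) c v := fun c hc' hlt => by
            have e1 := hB (rank u) (by omega) c hc' u
            have e2 := Nat.mul_le_mul_right B hlt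
            rw [Nat.succ_mul] at e2
            omega
          refine ⟨hmono (by omega) h1, fun c hc' hle' => ?_, fun hb => ?_⟩
          · by_cases hc'' : c = i
            · simpa [hc''] using hle
            · have hc3 := (List.mem_cons.1 hc').resolve_left hc''
              simp only [hc'', if_false]
              rcases hle.lt_or_eq with hlt | heq
              · exact (key c hc3 hlt).le
              · rw [heq]; exact Nat.add_le_add_left (h2 c hc3 hle') _
          · have hc3 := (List.mem_cons.1 hc).resolve_left hci
            simp only [hci, if_false]
            rcases hle.lt_or_eq with hlt | heq
            · exact key _ hc3 hlt
            · rw [heq]; exact Nat.add_lt_add_left (h3 hb) _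

/-- The positional strategy `g` of player `p` wins from all vertices in `W`. -/
structure PosWins (G : ParityGame V) (p : Player) (W : Set V) (g : V → V) : Prop where
  move : ∀ v ∈ W, G.owner v = p → G.edge v (g v) ∧ g v ∈ W
  closed : ∀ v ∈ W, G.owner v ≠ p → ∀ u, G.edge v u → u ∈ W
  win : ∀ ρ : ℕ → V, (∀ i, ρ i ∈ W) → (∀ i, G.edge (ρ i) (ρ (i + 1))) →
    (∀ i, G.owner (ρ i) = p → ρ (i + 1) = g (ρ i)) → G.WinCond ρ p

/-- If the limit color `m` were bad, its measure would eventually never increase, yet decrease at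
each of the infinitely many visits to color `m`. -/
theorem Certificate.good {p : Player} {cs : List ℕ} {Z : ℕ → Set V} {W : Set V} {g : V → V}
    {μ : ℕ → V → ℕ} (h : Certificate G p cs Z W g μ) (hcs : ∀ v, G.color v ∈ cs) {ρ : ℕ → V}
    (hW : ∀ i, ρ i ∈ W) (hE : ∀ i, G.edge (ρ i) (ρ (i + 1)))
    (hg : ∀ i, G.owner (ρ i) = p → ρ (i + 1) = g (ρ i)) {m : ℕ}
    (hm : ∃ᶠ i in Filter.atTop, G.color (ρ i) = m)
    (hle : ∀ᶠ i in Filter.atTop, G.color (ρ i) ≤ m) : Good p m := by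
  by_contra hb
  have hP : ∀ i, Progress G p cs Z W μ (ρ i) (ρ (i + 1)) := fun i => by
    by_cases ho : G.owner (ρ i) = p
    · rw [hg i ho]; exact ((h _ (hW i)).1 ho).2
    · exact (h _ (hW i)).2 ho _ (hE i)
  obtain ⟨i₀, hi₀⟩ := Filter.eventually_atTop.1 hle
  have hmc : m ∈ cs := by
    obtain ⟨i, hi⟩ := hm.exists
    exact hi ▸ hcs _
  have hanti : ∀ i ≥ i₀, ∀ j ≥ i, μ m (ρ j) ≤ μ m (ρ i) := fun i hi j hj => by
    induction j, hj using Nat.le_induction with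
    | base => exact le_rfl
    | succ j hj ih => exact (((hP j).2 (hcs _)).2.1 m hmc (hi₀ j (by omega))).trans ih
  have hdesc : ∀ K, ∃ i ≥ i₀, μ m (ρ i) + K ≤ μ m (ρ i₀) := fun K => by
    induction K with
    | zero => exact ⟨i₀, le_rfl, le_rfl⟩
    | succ K ih =>
      obtain ⟨i, hi, hK⟩ := ih
      obtain ⟨j, hj, hjm⟩ := Filter.frequently_atTop.1 hm i
      have h1 := ((hP j).2 (hcs _)).2.2 (by rwa [hjm])
      rw [hjm] at h1
      have h2 := hanti i hi j hj
      exact ⟨j + 1, by omega, by omega⟩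
  obtain ⟨i, _, hi⟩ := hdesc (μ m (ρ i₀) + 1)
  omega

/-- Take the largest of the finitely many values that are attained infinitely often. -/
theorem exists_limsup {u : ℕ → ℕ} {S : Finset ℕ} (h : ∀ i, u i ∈ S) :
    ∃ m, (∃ᶠ i in Filter.atTop, u i = m) ∧ ∀ᶠ i in Filter.atTop, u i ≤ m := by
  classical
  set T := S.filter fun m => ∃ᶠ i in Filter.atTop, u i = m with hT
  have hne : T.Nonempty := by
    by_contra hemp
    have : ∀ m ∈ S, ∀ᶠ i in Filter.atTop, u i ≠ m := fun m hm => by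
      by_contra hf
      exact hemp ⟨m, Finset.mem_filter.2 ⟨hm, hf⟩⟩
    obtain ⟨i, hi⟩ := ((Filter.eventually_all_finset S).2 this).exists
    exact hi _ (h i) rfl
  refine ⟨T.max' hne, (Finset.mem_filter.1 (T.max'_mem hne)).2, ?_⟩
  have : ∀ m ∈ S, ∀ᶠ i in Filter.atTop, u i = m → m ≤ T.max' hne := fun m hm => by
    by_cases hf : ∃ᶠ i in Filter.atTop, u i = m
    · exact .of_forall fun _ _ => T.le_max' m (Finset.mem_filter.2 ⟨hm, hf⟩)
    · exact (Filter.not_frequently.1 hf).mono fun i hi hi' => absurd hi' hi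
  exact ((Filter.eventually_all_finset S).2 this).mono fun i hi => hi _ (h i) rfl

/-- Once `cs` contains all colors, the sets `Z` play no role, and progress means staying in `W`. -/
theorem Certificate.posWins {p : Player} {cs : List ℕ} {Z : ℕ → Set V} {W : Set V} {g : V → V}
    {μ : ℕ → V → ℕ} (h : Certificate G p cs Z W g μ) (hcs : ∀ v, G.color v ∈ cs) :
    PosWins G p W g where
  move v hv ho := ⟨((h v hv).1 ho).1, (((h v hv).1 ho).2.2 (hcs v)).1⟩
  closed v hv ho u hu := (((h v hv).2 ho u hu).2 (hcs v)).1
  win ρ hW hE hg := by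
    cases p with
    | O =>
      obtain ⟨m, hm, hle⟩ := exists_limsup (u := fun i => G.color (ρ i)) (S := cs.toFinset)
        (by simp [hcs])
      exact ⟨m, by simpa [Good] using h.good hcs hW hE hg hm hle, hm, hle⟩
    | I =>
      rintro ⟨m, he, hm, hle⟩
      have := h.good hcs hW hE hg hm hle
      simp [Good, he] at this

/-- Positional determinacy: each player wins from the nested fixed point of that player. -/
theorem exists_posWins [Fintype V] (p : Player) {N : ℕ} (hN : Fintype.card V ≤ N)
    {cs : List ℕ} (hcs : cs.Pairwise (· > ·)) (hc : ∀ v, G.color v ∈ cs) (Z : ℕ → Set V) :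
    ∃ g, PosWins G p (G.solve p N cs Z) g :=
  let ⟨g, _, h⟩ := exists_certificate hN cs hcs Z
  ⟨g, h.posWins hc⟩

theorem PosWins.wins {p : Player} {W : Set V} {g : V → V} (h : PosWins G p W g)
    (hW : G.init ∈ W) : G.Wins p := by
  have hf : ∀ (ρ : ℕ → V) m, ((List.range (m + 1)).map ρ).getLastD G.init = ρ m := by
    simp [List.range_succ]
  have hmem : ∀ (ρ : ℕ → V) m, G.Consistent p (fun l => g (l.getLastD G.init)) ρ m →
      ρ m ∈ W := fun ρ m => by
    induction m with
    | zero => intro hc; rw [hc.1]; exact hW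
    | succ m ih =>
      intro hc
      have hm := ih ⟨hc.1, fun i hi => hc.2 i (by omega)⟩
      obtain ⟨h1, h2⟩ := hc.2 m (by omega)
      by_cases ho : G.owner (ρ m) = p
      · rw [h2 ho]; simp only [hf]; exact (h.move _ hm ho).2
      · exact h.closed _ hm ho _ h1
  refine ⟨fun l => g (l.getLastD G.init), fun ρ m hc ho => ?_, fun ρ hc => ?_⟩
  · simp only [hf]
    exact (h.move _ (hmem ρ m hc) ho).1
  · refine h.win ρ (fun i => hmem ρ i (hc i)) (fun i => ((hc (i + 1)).2 i (by omega)).1)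
      fun i ho => ?_
    rw [((hc (i + 1)).2 i (by omega)).2 ho]
    simp only [hf]

/-- The two strategies are played against each other. Neither gets stuck, so the result is an
infinite play that both players would win. -/
theorem Wins.unique (hO : G.Wins .O) (hI : G.Wins .I) : False := by
  classical
  obtain ⟨f, hf, hfw⟩ := hO
  obtain ⟨f', hf', hfw'⟩ := hI
  set H : ℕ → List V := fun i => Nat.rec [G.init]
    (fun _ l => l ++ [if G.owner (l.getLastD G.init) = .O then f l else f' l]) i with hH
  have hHs : ∀ i, H (i + 1) =
    H i ++ [if G.owner ((H i).getLastD G.init) = .O then f (H i) else f' (H i)] := fun _ => rfl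
  set ρ : ℕ → V := fun i => (H i).getLastD G.init with hρ
  have hmap : ∀ i, (List.range (i + 1)).map ρ = H i := fun i => by
    induction i with
    | zero => simp [hρ, hH]
    | succ i ih =>
      rw [List.range_succ, List.map_append, ih, hHs]
      simp [hρ, hHs]
  have hstep : ∀ i, ρ (i + 1) = if G.owner (ρ i) = .O then f (H i) else f' (H i) := fun i => by
    simp [hρ, hHs]
  have hcons : ∀ m, G.Consistent .O f ρ m ∧ G.Consistent .I f' ρ m := fun m => by
    induction m with
    | zero => exact ⟨⟨rfl, by simp⟩, ⟨rfl, by simp⟩⟩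
    | succ m ih =>
      have hE : G.edge (ρ m) (ρ (m + 1)) := by
        rw [hstep]
        cases ho : G.owner (ρ m) with
        | O => simpa [hmap] using hf ρ m ih.1 ho
        | I => simpa [hmap] using hf' ρ m ih.2 ho
      refine ⟨⟨rfl, fun i hi => ?_⟩, ⟨rfl, fun i hi => ?_⟩⟩
      · rcases Nat.lt_succ_iff_lt_or_eq.1 hi with hi | rfl
        · exact ih.1.2 i hi
        · exact ⟨hE, fun ho => by rw [hstep, hmap, if_pos ho]⟩
      · rcases Nat.lt_succ_iff_lt_or_eq.1 hi with hi | rfl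
        · exact ih.2.2 i hi
        · exact ⟨hE, fun ho => by rw [hstep, hmap, ho]; simp⟩
  exact hfw' ρ (fun m => (hcons m).2) (hfw ρ fun m => (hcons m).1)

theorem PosWins.comap {V' : Type*} {H : ParityGame V'} {e : V ≃ V'} (he : IsIso G H e)
    {p : Player} {W : Set V'} {g : V' → V'} (h : PosWins H p W g) :
    PosWins G p (e ⁻¹' W) (fun v => e.symm (g (e v))) where
  move v hv ho := by
    have := h.move (e v) hv (by rw [he.owner, ho])
    refine ⟨(he.edge _ _).1 (by simpa using this.1), by simpa using this.2⟩
  closed v hv ho u hu := h.closed (e v) hv (by rwa [he.owner]) _ ((he.edge _ _).2 hu)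
  win ρ hW hE hg := by
    have := h.win (fun i => e (ρ i)) hW (fun i => (he.edge _ _).2 (hE i)) fun i ho => by
      rw [hg i (by rwa [← he.owner])]; simp
    cases p <;> simpa [WinCond, he.color] using this

end ParityGame

/-! ### The abstract game and its arena -/

namespace DPA

/-- Inserting a lower bound between the elements of a sequence does not affect acceptance. -/
theorem parityAccepting_interleave {u w : ℕ → ℕ} {b : ℕ} (h0 : w 0 = b)
    (h1 : ∀ i, w (2 * i + 1) = b) (h2 : ∀ i, w (2 * i + 2) = u i) (hb : ∀ i, b ≤ u i) :
    ParityAccepting w ↔ ParityAccepting u := by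
  have hcases : ∀ j, w j = b ∨ ∃ i, j = 2 * i + 2 ∧ w j = u i := fun j => by
    rcases Nat.even_or_odd' j with ⟨i, rfl | rfl⟩
    · cases i with
      | zero => exact .inl h0
      | succ i => exact .inr ⟨i, by ring, h2 i⟩
    · exact .inl (h1 i)
  have hle : ∀ m, (∀ᶠ j in Filter.atTop, w j ≤ m) ↔ ∀ᶠ i in Filter.atTop, u i ≤ m := fun m => by
    simp only [Filter.eventually_atTop]
    constructor
    · rintro ⟨j₀, hj⟩
      exact ⟨j₀, fun i hi => h2 i ▸ hj _ (by omega)⟩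
    · rintro ⟨i₀, hi⟩
      refine ⟨2 * i₀ + 2, fun j hj => ?_⟩
      rcases hcases j with h | ⟨i, rfl, h⟩
      · rw [h]; exact (hb i₀).trans (hi i₀ le_rfl)
      · rw [h]; exact hi i (by omega)
  constructor
  · rintro ⟨m, he, hm, hm'⟩
    have hu := (hle m).1 hm'
    refine ⟨m, he, ?_, hu⟩
    -- The inserted values may account for `m` only if `m = b`; then `u` is eventually squeezed
    -- between `b` and `m`.
    by_cases hmb : m = b
    · exact (hu.mono fun i hi => le_antisymm hi (hmb ▸ hb i)).frequently
    · rw [Filter.frequently_atTop] at hm ⊢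
      intro i₀
      obtain ⟨j, hj, hjm⟩ := hm (2 * i₀ + 2)
      rcases hcases j with h | ⟨i, rfl, h⟩
      · exact absurd (hjm ▸ h) hmb
      · exact ⟨i, by omega, h ▸ hjm⟩
  · rintro ⟨m, he, hm, hm'⟩
    refine ⟨m, he, ?_, (hle m).2 hm'⟩
    rw [Filter.frequently_atTop] at hm ⊢
    intro j₀
    obtain ⟨i, hi, him⟩ := hm j₀
    exact ⟨2 * i + 2, by omega, (h2 i).trans him⟩

variable {Q I O : Type*} {𝔄 : DPA Q (I × O)} {k : ℕ}

theorem dom_behavior (D : Set 𝔄.Pos) (w : List I) : dom (𝔄.behavior D w) = D := by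
  ext x
  by_cases h : x ∈ D <;> simp [dom, behavior, h]

theorem dom_nonempty (r : 𝔄.behaviors k) : (dom r.1).Nonempty := by
  obtain ⟨r, w, D, _, hD, rfl⟩ := r
  rwa [dom_behavior]

/-- The play of the arena that corresponds to a sequence of rounds. -/
def arenaPlay (ρ : ℕ → 𝔄.behaviors k × 𝔄.Pos) : ℕ → 𝔄.Vertex k
  | 0 => .start
  | j + 1 => if j % 2 = 0 then .fn (ρ (j / 2)).1 else .pair (ρ (j / 2)).1 (ρ (j / 2)).2

theorem arenaPlay_fn (ρ : ℕ → 𝔄.behaviors k × 𝔄.Pos) (i : ℕ) :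
    arenaPlay ρ (2 * i + 1) = .fn (ρ i).1 := by
  simp [arenaPlay]

theorem arenaPlay_pair (ρ : ℕ → 𝔄.behaviors k × 𝔄.Pos) (i : ℕ) :
    arenaPlay ρ (2 * i + 2) = .pair (ρ i).1 (ρ i).2 := by
  have h2 : (2 * i + 1) / 2 = i := by omega
  simp [arenaPlay, h2]

theorem parityAccepting_arenaPlay (ρ : ℕ → 𝔄.behaviors k × 𝔄.Pos) :
    (ParityAccepting fun j => (𝔄.arena k).color (arenaPlay ρ j)) ↔
      ParityAccepting fun i => ((ρ i).2.2 : ℕ) :=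
  parityAccepting_interleave (b := sInf (Set.range 𝔄.color)) rfl
    (fun i => by rw [arenaPlay_fn]; rfl) (fun i => by rw [arenaPlay_pair]; rfl)
    fun i => Nat.sInf_le (ρ i).2.2.2

theorem arenaPlay_edge {ρ : ℕ → 𝔄.behaviors k × 𝔄.Pos} (h : 𝔄.IsPlay k ρ) (j : ℕ) :
    (𝔄.arena k).edge (arenaPlay ρ j) (arenaPlay ρ (j + 1)) := by
  rcases Nat.even_or_odd' j with ⟨i, rfl | rfl⟩
  · cases i with
    | zero => exact h.start
    | succ i =>
      rw [arenaPlay_fn, show 2 * (i + 1) = 2 * i + 2 by ring, arenaPlay_pair]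
      exact h.next i
  · rw [arenaPlay_fn, arenaPlay_pair]
    exact ⟨rfl, h.answer i⟩

/-- A positional winning strategy of Player `O` in the arena wins the abstract game. -/
theorem oWins_of_posWins {W : Set (𝔄.Vertex k)} {g : 𝔄.Vertex k → 𝔄.Vertex k}
    (h : (𝔄.arena k).PosWins .O W g) (hW : .start ∈ W) : 𝔄.OWins k := by
  classical
  -- A strategy of the abstract game has to answer legally everywhere, whereas `g` is reliable only
  -- on `W`. Elsewhere any element of the non-empty domain is chosen.
  refine ⟨fun _ r => if hx : ∃ x, g (.fn r) = .pair r x ∧ x ∈ dom r.1 then hx.choose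
    else (dom_nonempty r).choose, fun _ r => ?_, fun ρ hρ hσ => ?_⟩
  · by_cases hx : ∃ x, g (.fn r) = .pair r x ∧ x ∈ dom r.1
    · simp only [dif_pos hx]; exact hx.choose_spec.2
    · simp only [dif_neg hx]; exact (dom_nonempty r).choose_spec
  have hmove : ∀ r, .fn r ∈ W → ∃ x, g (.fn r) = .pair r x ∧ x ∈ dom r.1 := fun r hr => by
    have := (h.move _ hr rfl).1
    cases hg : g (.fn r) with
    | start => rw [hg] at this; exact this.elim
    | fn r' => rw [hg] at this; exact this.elim
    | pair r' x =>
      rw [hg] at this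
      obtain ⟨rfl, hx⟩ := this
      exact ⟨x, rfl, hx⟩
  have hfollow : ∀ i, .fn (ρ i).1 ∈ W → .pair (ρ i).1 (ρ i).2 = g (.fn (ρ i).1) := fun i hi => by
    have hx := hmove _ hi
    have := hσ i
    simp only [dif_pos hx] at this
    rw [this]
    exact hx.choose_spec.1.symm
  have hmem : ∀ j, arenaPlay ρ j ∈ W := fun j => by
    induction j with
    | zero => exact hW
    | succ j ih =>
      have hE := arenaPlay_edge hρ j
      rcases Nat.even_or_odd' j with ⟨i, rfl | rfl⟩
      · refine h.closed _ ih ?_ _ hE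
        cases i with
        | zero => simp [arenaPlay, arena]
        | succ i => rw [show 2 * (i + 1) = 2 * i + 2 by ring, arenaPlay_pair]; simp [arena]
      · rw [arenaPlay_fn] at ih
        rw [arenaPlay_pair, hfollow i ih]
        exact (h.move _ ih rfl).2
  refine (parityAccepting_arenaPlay ρ).1 (h.win _ hmem (arenaPlay_edge hρ) fun j hj => ?_)
  rcases Nat.even_or_odd' j with ⟨i, rfl | rfl⟩
  · cases i with
    | zero => simp [arenaPlay, arena] at hj
    | succ i =>
      rw [show 2 * (i + 1) = 2 * i + 2 by ring, arenaPlay_pair] at hj; simp [arena] at hj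
  · have := hmem (2 * i + 1)
    rw [arenaPlay_fn] at this
    rw [arenaPlay_fn, arenaPlay_pair, hfollow i this]

/-- If Player `I` has a positional winning strategy in the arena, then Player `O` does not win the
abstract game. -/
theorem not_oWins_of_posWins {W : Set (𝔄.Vertex k)} {g : 𝔄.Vertex k → 𝔄.Vertex k}
    (h : (𝔄.arena k).PosWins .I W g) (hW : .start ∈ W) : ¬ 𝔄.OWins k := by
  rintro ⟨σ, hσ, hwin⟩
  have hfn : ∀ v ∈ W, (𝔄.arena k).owner v = .I → ∃ r, g v = .fn r := fun v hv ho => by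
    have := (h.move v hv ho).1
    cases hg : g v with
    | fn r => exact ⟨r, rfl⟩
    | start => rw [hg] at this; cases v <;> exact this.elim
    | pair r x =>
      rw [hg] at this
      cases v with
      | fn r => simp [arena] at ho
      | _ => exact this.elim
  -- A default value for histories at which `g` does not lead to a function; it is never used in the
  -- play constructed below.
  obtain ⟨r₀, _⟩ := hfn _ hW rfl
  set cur : List (𝔄.behaviors k × 𝔄.Pos) → 𝔄.Vertex k := fun l =>
    (l.map fun x => Vertex.pair x.1 x.2).getLastD .start with hcur
  set rnd : List (𝔄.behaviors k × 𝔄.Pos) → 𝔄.behaviors k × 𝔄.Pos := fun l =>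
    let r := match g (cur l) with
      | .fn r => r
      | _ => r₀
    (r, σ l r) with hrnd
  -- The histories of the play in which Player `I` follows `g` and Player `O` follows `σ`.
  set H : ℕ → List (𝔄.behaviors k × 𝔄.Pos) := fun i =>
    Nat.rec [] (fun _ l => l ++ [rnd l]) i with hH
  have hHs : ∀ i, H (i + 1) = H i ++ [rnd (H i)] := fun _ => rfl
  set ρ : ℕ → 𝔄.behaviors k × 𝔄.Pos := fun i => rnd (H i) with hρ
  have hmap : ∀ i, (List.range i).map ρ = H i := fun i => by
    induction i with
    | zero => rfl
    | succ i ih => rw [List.range_succ, List.map_append, ih, hHs]; rfl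
  have hcurH : ∀ i, cur (H i) = arenaPlay ρ (2 * i) := fun i => by
    cases i with
    | zero => rfl
    | succ i =>
      rw [show 2 * (i + 1) = 2 * i + 2 by ring, arenaPlay_pair, hHs]
      simp [hcur, hρ]
  have howner : ∀ i, (𝔄.arena k).owner (arenaPlay ρ (2 * i)) = .I := fun i => by
    cases i with
    | zero => rfl
    | succ i => rw [show 2 * (i + 1) = 2 * i + 2 by ring, arenaPlay_pair]; rfl
  have hanswer : ∀ i, (ρ i).2 ∈ dom (ρ i).1.1 := fun i => hσ _ _
  have hodd : ∀ i, arenaPlay ρ (2 * i) ∈ W → arenaPlay ρ (2 * i + 1) = g (arenaPlay ρ (2 * i)) :=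
    fun i hi => by
      obtain ⟨r, hr⟩ := hfn _ hi (howner i)
      rw [arenaPlay_fn, hr]
      change Vertex.fn (match g (cur (H i)) with
        | .fn r => r
        | _ => r₀) = _
      rw [hcurH, hr]
  have heven : ∀ i, arenaPlay ρ (2 * i) ∈ W := fun i => by
    induction i with
    | zero => exact hW
    | succ i ih =>
      have h1 := (h.move _ ih (howner i)).2
      rw [← hodd i ih, arenaPlay_fn] at h1
      rw [show 2 * (i + 1) = 2 * i + 2 by ring, arenaPlay_pair]
      exact h.closed _ h1 (by simp [arena]) _ ⟨rfl, hanswer i⟩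
  have hedge : ∀ i, (𝔄.arena k).edge (arenaPlay ρ (2 * i)) (arenaPlay ρ (2 * i + 1)) := fun i => by
    rw [hodd i (heven i)]
    exact (h.move _ (heven i) (howner i)).1
  have hplay : 𝔄.IsPlay k ρ := by
    refine ⟨hedge 0, fun i => ?_, hanswer⟩
    have := hedge (i + 1)
    rw [arenaPlay_fn, show 2 * (i + 1) = 2 * i + 2 by ring, arenaPlay_pair] at this
    exact this
  refine h.win (arenaPlay ρ) (fun j => ?_) (arenaPlay_edge hplay) (fun j hj => ?_)
    ((parityAccepting_arenaPlay ρ).2 (hwin ρ hplay fun i => by rw [hmap]))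
  · rcases Nat.even_or_odd' j with ⟨i, rfl | rfl⟩
    · exact heven i
    · rw [hodd i (heven i)]
      exact (h.move _ (heven i) (howner i)).2
  · rcases Nat.even_or_odd' j with ⟨i, rfl | rfl⟩
    · exact hodd i (heven i)
    · rw [arenaPlay_fn] at hj; simp [arena] at hj

end DPA
end DelayGame

namespace DelayGame
open Enc

/-! ### The algorithm -/

/-- The inputs of the algorithm. -/
structure Input where
  n : ℕ
  s : ℕ
  t : ℕ
  k : ℕ
  aut : DPA (Fin n) (Fin s × Fin t)
  s_pos : 0 < s
  t_pos : 0 < t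
  k_pos : 0 < k
  k_le : k ≤ 2 ^ (n ^ 2 * aut.numColors + 1)

/-- The code of a position: a state and a color. -/
abbrev PosCode := ℕ × ℕ

/-- The code of a function from the states to sets of positions. -/
abbrev FunCode := List (ℕ × List PosCode)

/-- The code of a partial function from positions to sets of positions. -/
abbrev BehCode := List (PosCode × List PosCode)

/-- The code of a vertex of the arena: two tags, which tell whether the vertex is a function or a
pair, a function, and a position. -/
abbrev VertexCode := (Bool × Bool) × (BehCode × PosCode)

/-- Insertion into a decreasing list without duplicates. -/
def insertColor (x : ℕ) (l : List ℕ) : List ℕ :=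
  l.filter (fun y => !Nat.ble y x) ++ x :: l.filter (fun y => !Nat.ble x y)

/-- The elements of a list in decreasing order, without duplicates. -/
def sortColors (l : List ℕ) : List ℕ := l.foldr insertColor []

/-- The value of a function at a state. -/
def FunCode.value (f : FunCode) (q : ℕ) : List PosCode :=
  f.flatMap fun p => bif p.1 == q then p.2 else []

namespace Input

/-- The number of the initial state. -/
def initState (γ : Input) : ℕ := γ.aut.init

/-- The table of the transitions. -/
def table (γ : Input) : List (List (List ℕ)) :=
  List.ofFn fun q => List.ofFn fun a => List.ofFn fun b => ((γ.aut.step q (a, b) : Fin γ.n) : ℕ)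

/-- The table of the colors of the states. -/
def colorTable (γ : Input) : List ℕ := List.ofFn γ.aut.color

/-- The summand `2 ^ γ.n ^ 4` turns the permitted exponential dependence on `n` into a polynomial
dependence on the weight. The exponent `4` is dictated by the nested fixed point: about `2 ^ n ^ 3`
vertices to the power `n`. -/
instance : Enc Input :=
  ⟨fun γ => encodeInput γ.aut γ.k, fun γ => (encodeInput γ.aut γ.k).size + 1 + 2 ^ γ.n ^ 4,
    fun _ => Nat.lt_of_lt_of_le (Nat.lt_succ_self _) (Nat.le_add_right _ _)⟩

/-- The transitions: a state, an input letter, and the next state. -/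
def trans (γ : Input) : List (ℕ × (ℕ × ℕ)) :=
  γ.table.zipIdx.flatMap fun x => x.1.zipIdx.flatMap fun y => y.1.map fun q' => (x.2, (y.2, q'))

def letters (γ : Input) : List ℕ := γ.trans.map fun τ => τ.2.1

/-- The colors of the states: a color and a state. -/
def stateColors (γ : Input) : List (ℕ × ℕ) := γ.colorTable.zipIdx

def colors (γ : Input) : List ℕ := sortColors γ.colorTable

/-- The default `0` is never used, since the initial state has a color. -/
def minColor (γ : Input) : ℕ :=
  (γ.colors.filter fun c => γ.colors.all fun d => Nat.ble c d).headD 0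

def positions (γ : Input) : List PosCode :=
  γ.stateColors.flatMap fun c => γ.colors.map fun e => (c.2, e)

/-- The power set construction. -/
def stepSet (γ : Input) (X : List PosCode) (a : ℕ) : List PosCode :=
  γ.positions.filter fun y => X.any fun x => γ.trans.any fun τ =>
    τ.1 == x.1 && (τ.2.1 == a && (τ.2.2 == y.1 && γ.stateColors.any fun c =>
      c.2 == y.1 && y.2 == bif Nat.ble x.2 c.1 then c.1 else x.2))

def initSet (γ : Input) (q : ℕ) : List PosCode :=
  γ.positions.filter fun y => y.1 == q && γ.stateColors.any fun c => c == (y.2, q)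

def stepFun (γ : Input) (f : FunCode) (a : ℕ) : FunCode :=
  f.map fun p => (p.1, γ.stepSet p.2 a)

def initFun (γ : Input) : FunCode := γ.stateColors.map fun c => (c.2, γ.initSet c.2)

def stepLayer (γ : Input) (L : List FunCode) : List FunCode :=
  nub (L.flatMap fun f => γ.letters.map fun a => γ.stepFun f a)

/-- The functions that are realized by words of length `k`. -/
def layer (γ : Input) : List FunCode :=
  (List.replicate γ.k ()).foldl (fun L _ => γ.stepLayer L) [γ.initFun]

def positionSets (γ : Input) : List (List PosCode) := γ.positions.sublists'

def behaviorList (γ : Input) : List BehCode :=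
  nub (γ.positionSets.flatMap fun D => bif D == [] then [] else
    γ.layer.map fun f => D.map fun x => (x, f.value x.1))

def vertexList (γ : Input) : List VertexCode :=
  ((false, false), ([], (0, 0))) :: (γ.behaviorList.map (fun r => ((true, false), (r, (0, 0)))) ++
    γ.behaviorList.flatMap fun r => γ.positions.map fun x => ((false, true), (r, x)))

/-- The first components of the code of a function list its domain in the order of `positions`, so
the condition on domains is an equality of lists. -/
def edge (γ : Input) (v v' : VertexCode) : Bool :=
  (!v.1.1 && (v'.1.1 && bif v.1.2 then
      v.2.1.any fun e => e.1 == v.2.2 && e.2 == v'.2.1.map Prod.fst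
    else v'.2.1.map Prod.fst == γ.initSet γ.initState)) ||
  (v.1.1 && (v'.1.2 && (v'.2.1 == v.2.1 && v.2.1.any fun e => e.1 == v'.2.2)))

def vertexColor (γ : Input) (v : VertexCode) : ℕ := bif v.1.2 then v.2.2.2 else γ.minColor

/-- Can Player `O` force the next vertex to be in the set for the current color? -/
def canForce (γ : Input) (Z : List (ℕ × VertexCode)) (v : VertexCode) : Bool :=
  bif v.1.1 then
    γ.vertexList.any fun u => γ.edge v u && Z.any fun z => z == (γ.vertexColor v, u)
  else γ.vertexList.all fun u => !γ.edge v u || Z.any fun z => z == (γ.vertexColor v, u)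

/-- The pairs of a color and a vertex. -/
def coloredVertices (γ : Input) : List (ℕ × VertexCode) :=
  γ.colors.flatMap fun c => γ.vertexList.map fun v => (c, v)

/-- Execute an instruction of the fixed point computation: reset the set for a color, assign the
last result to a color, or compute a new result. -/
def exec (γ : Input) (st : List (ℕ × VertexCode) × List VertexCode) (i : (Bool × Bool) × ℕ) :
    List (ℕ × VertexCode) × List VertexCode :=
  bif i.1.1 then
    (γ.coloredVertices.filter fun x => bif x.1 == i.2 then
      (bif i.1.2 then !i.2.bodd else st.2.any fun v => v == x.2) else st.1.any fun z => z == x, st.2)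
  else (st.1, γ.vertexList.filter fun v => γ.canForce st.1 v)

/-- The instructions that compute the nested fixed point for some colors. -/
def instrs (γ : Input) (cs : List ℕ) : List ((Bool × Bool) × ℕ) :=
  cs.foldr (fun i I => ((true, true), i) :: γ.vertexList.flatMap fun _ => I ++ [((true, false), i)])
    [((false, false), 0)]

def winRegion (γ : Input) : List VertexCode :=
  ((γ.instrs γ.colors).foldl γ.exec ([], [])).2

def winnerIsO (γ : Input) : Bool :=
  γ.winRegion.any fun v => v == ((false, false), ([], (0, 0)))

def output (γ : Input) : (ℕ × (List Bool × (List ℕ × List (List Bool)))) × Bool :=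
  ((0, (γ.vertexList.map fun v => v.1.1, (γ.vertexList.map γ.vertexColor,
    γ.vertexList.map fun v => γ.vertexList.map fun v' => γ.edge v v'))), γ.winnerIsO)

end Input

/-! ### Polynomial-time subroutines -/

variable {α : Type} [Enc α]

theorem Input.poly_tuple : Poly fun γ : Input =>
    ((γ.initState, (γ.table, γ.colorTable)), γ.k) :=
  .of_enc_eq (fun _ => rfl) fun γ => by
    rw [EncExact.wt_eq]
    change _ ≤ (encodeInput γ.aut γ.k).size + 1 + 2 ^ γ.n ^ 4
    exact Nat.le_add_right _ _

@[fun_prop] theorem Input.poly_initState : Poly Input.initState :=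
  Poly.fst.comp (Poly.fst.comp poly_tuple)

@[fun_prop] theorem Input.poly_table : Poly Input.table :=
  Poly.fst.comp (Poly.snd.comp (Poly.fst.comp poly_tuple))

@[fun_prop] theorem Input.poly_colorTable : Poly Input.colorTable :=
  Poly.snd.comp (Poly.snd.comp (Poly.fst.comp poly_tuple))

@[fun_prop] theorem Input.poly_k : Poly Input.k := Poly.snd.comp poly_tuple

theorem sortColors_spec (l : List ℕ) :
    (sortColors l).Pairwise (· > ·) ∧ ∀ x, x ∈ sortColors l ↔ x ∈ l := by
  induction l with
  | nil => simp [sortColors]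
  | cons y l ih =>
    have : sortColors (y :: l) = insertColor y (sortColors l) := rfl
    rw [this]
    have hble : ∀ a b : ℕ, (!Nat.ble a b) = true ↔ b < a := fun a b => by
      rw [Bool.not_eq_true', ← Bool.not_eq_true, Nat.ble_eq, not_le]
    refine ⟨?_, fun x => ?_⟩
    · rw [insertColor, List.pairwise_append, List.pairwise_cons]
      simp only [List.mem_filter, List.mem_cons, hble]
      refine ⟨ih.1.filter _, ⟨fun x hx => hx.2, ih.1.filter _⟩, fun x hx z hz => ?_⟩
      rcases hz with rfl | hz <;> omega
    · simp only [insertColor, List.mem_append, List.mem_filter, List.mem_cons, ih.2, hble]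
      by_cases h : x = y
      · simp [h]
      · simp only [h, false_or]
        exact ⟨fun h => h.elim And.left And.left, fun hx => by
          rcases Nat.lt_or_gt_of_ne h with h | h
          · exact .inr ⟨hx, h⟩
          · exact .inl ⟨hx, h⟩⟩

@[fun_prop] theorem Poly.sortColors {l : α → List ℕ} (hl : Poly l) :
    Poly fun a => sortColors (l a) := by
  refine Poly.foldr (g := fun _ x r => insertColor x r) (by unfold insertColor; fun_prop)
    (.const []) hl hl.wt_bd fun a l' h => ?_
  have := sortColors_spec l'
  exact wt_le_of_nodup (this.1.imp fun h => ne_of_gt h) fun x hx => h.subset ((this.2 x).1 hx)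

@[fun_prop] theorem Poly.value {f : α → FunCode} {q : α → ℕ} (hf : Poly f) (hq : Poly q) :
    Poly fun a => (f a).value (q a) := by
  unfold FunCode.value; fun_prop

namespace Input

@[fun_prop] theorem poly_trans : Poly trans := by unfold trans; fun_prop
@[fun_prop] theorem poly_letters : Poly letters := by unfold letters; fun_prop
@[fun_prop] theorem poly_stateColors : Poly stateColors := by unfold stateColors; fun_prop
@[fun_prop] theorem poly_colors : Poly colors := by unfold colors; fun_prop
@[fun_prop] theorem poly_minColor : Poly minColor := by unfold minColor; fun_prop
@[fun_prop] theorem poly_positions : Poly positions := by unfold positions; fun_prop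

@[fun_prop] theorem poly_stepSet {γ : α → Input} {X : α → List PosCode} {b : α → ℕ}
    (hγ : Poly γ) (hX : Poly X) (hb : Poly b) : Poly fun a => (γ a).stepSet (X a) (b a) := by
  unfold stepSet; fun_prop

@[fun_prop] theorem poly_initSet {γ : α → Input} {q : α → ℕ}
    (hγ : Poly γ) (hq : Poly q) : Poly fun a => (γ a).initSet (q a) := by
  unfold initSet; fun_prop

@[fun_prop] theorem poly_stepFun {γ : α → Input} {f : α → FunCode} {b : α → ℕ}
    (hγ : Poly γ) (hf : Poly f) (hb : Poly b) : Poly fun a => (γ a).stepFun (f a) (b a) := by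
  unfold stepFun; fun_prop

@[fun_prop] theorem poly_initFun : Poly initFun := by unfold initFun; fun_prop

@[fun_prop] theorem poly_stepLayer {γ : α → Input} {L : α → List FunCode}
    (hγ : Poly γ) (hL : Poly L) : Poly fun a => (γ a).stepLayer (L a) := by
  unfold stepLayer; fun_prop

end Input
end DelayGame

namespace DelayGame
open Enc

/-! ### Correctness of the construction of the arena -/

theorem zipIdx_ofFn {β : Type*} {m : ℕ} (f : Fin m → β) :
    (List.ofFn f).zipIdx = List.ofFn fun i => (f i, (i : ℕ)) := by
  apply List.ext_getElem <;> simp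

theorem flatMap_cond {β δ : Type*} [DecidableEq β] {l : List β} (hl : l.Nodup) {a : β} (ha : a ∈ l)
    (g : β → List δ) : (l.flatMap fun x => bif decide (x = a) then g x else []) = g a := by
  induction l with
  | nil => simp at ha
  | cons x l ih =>
    rw [List.nodup_cons] at hl
    rw [List.flatMap_cons]
    by_cases h : x = a
    · subst h
      have : (l.flatMap fun y => bif decide (y = x) then g y else []) = [] := by
        rw [List.flatMap_eq_nil_iff]
        intro y hy
        have : y ≠ x := fun h => hl.1 (h ▸ hy)
        simp [this]
      simp [this]
    · rw [ih hl.2 ((List.mem_cons.1 ha).resolve_left (Ne.symm h))]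
      simp [h]

/-- Thus enumerating the sublists of `positions` enumerates the canonical codes of sets, each in the
order of `positions`. -/
theorem eq_filter_of_sublist {β : Type*} [DecidableEq β] {l l' : List β} (hl : l.Nodup)
    (h : l'.Sublist l) : l' = l.filter fun y => decide (y ∈ l') := by
  have h1 : l'.filter (fun y => decide (y ∈ l')) = l' := List.filter_eq_self.2 (by simp)
  have h2 := h.filter fun y => decide (y ∈ l')
  rw [h1] at h2
  refine h2.eq_of_length_le (List.subperm_of_subset (hl.filter _) fun y hy => ?_).length_le
  simpa using (List.mem_filter.1 hy).2

namespace Input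

variable (γ : Input)

theorem mem_trans (q a q' : ℕ) : (q, (a, q')) ∈ γ.trans ↔
    ∃ (q₀ : Fin γ.n) (a₀ : Fin γ.s) (b : Fin γ.t), q = q₀ ∧ a = a₀ ∧ q' = γ.aut.step q₀ (a₀, b) := by
  simp only [trans, table, zipIdx_ofFn, List.mem_flatMap, List.mem_ofFn, List.mem_map,
    Prod.mk.injEq]
  constructor
  · rintro ⟨_, ⟨q₀, rfl⟩, y, hy, z, hz, rfl, rfl, rfl⟩
    rw [zipIdx_ofFn, List.mem_ofFn] at hy
    obtain ⟨a₀, rfl⟩ := hy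
    rw [List.mem_ofFn] at hz
    obtain ⟨b, rfl⟩ := hz
    exact ⟨q₀, a₀, b, rfl, rfl, rfl⟩
  · rintro ⟨q₀, a₀, b, rfl, rfl, rfl⟩
    refine ⟨_, ⟨q₀, rfl⟩, (List.ofFn fun b => ((γ.aut.step q₀ (a₀, b) : Fin γ.n) : ℕ), (a₀ : ℕ)),
      ?_, _, ?_, rfl, rfl, rfl⟩
    · rw [zipIdx_ofFn, List.mem_ofFn]; exact ⟨a₀, rfl⟩
    · rw [List.mem_ofFn]; exact ⟨b, rfl⟩

/-- Letters are read off the transitions; none is lost, because there are a state and an output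
letter. -/
theorem mem_letters (a : ℕ) : a ∈ γ.letters ↔ ∃ a₀ : Fin γ.s, a = a₀ := by
  simp only [letters, List.mem_map]
  constructor
  · rintro ⟨⟨q, a, q'⟩, h, rfl⟩
    obtain ⟨q₀, a₀, b, -, h, -⟩ := (γ.mem_trans _ _ _).1 h
    exact ⟨a₀, h⟩
  · rintro ⟨a₀, rfl⟩
    exact ⟨_, (γ.mem_trans _ _ _).2 ⟨γ.aut.init, a₀, ⟨0, γ.t_pos⟩, rfl, rfl, rfl⟩, rfl⟩

theorem stateColors_eq : γ.stateColors = List.ofFn fun q => (γ.aut.color q, (q : ℕ)) :=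
  zipIdx_ofFn _

theorem mem_stateColors (e q : ℕ) :
    (e, q) ∈ γ.stateColors ↔ ∃ q₀ : Fin γ.n, e = γ.aut.color q₀ ∧ q = q₀ := by
  rw [stateColors_eq, List.mem_ofFn]
  simp [eq_comm]

theorem mem_colors (e : ℕ) : e ∈ γ.colors ↔ e ∈ Set.range γ.aut.color := by
  rw [colors, (sortColors_spec _).2, colorTable, List.mem_ofFn]
  rfl

theorem colors_pairwise : γ.colors.Pairwise (· > ·) := (sortColors_spec _).1

theorem colors_nodup : γ.colors.Nodup := γ.colors_pairwise.imp fun h => ne_of_gt h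

theorem minColor_eq : γ.minColor = sInf (Set.range γ.aut.color) := by
  have hne : (Set.range γ.aut.color).Nonempty := ⟨_, γ.aut.init, rfl⟩
  have hm := Nat.sInf_mem hne
  have hspec : ∀ c, c ∈ (γ.colors.filter fun c => γ.colors.all fun d => Nat.ble c d) ↔
      c = sInf (Set.range γ.aut.color) := fun c => by
    simp only [List.mem_filter, List.all_eq_true, Nat.ble_eq, mem_colors]
    constructor
    · exact fun h => le_antisymm (h.2 _ hm) (Nat.sInf_le h.1)
    · rintro rfl
      exact ⟨hm, fun d hd => Nat.sInf_le hd⟩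
  rw [minColor]
  cases h : (γ.colors.filter fun c => γ.colors.all fun d => Nat.ble c d) with
  | nil => have := (hspec _).2 rfl; rw [h] at this; simp at this
  | cons c l => exact (hspec c).1 (by rw [h]; simp)

/-- The code of a position. -/
def posCode (x : γ.aut.Pos) : PosCode := (x.1, x.2)

theorem posCode_injective : Function.Injective γ.posCode := fun x y h => by
  simp only [posCode, Prod.mk.injEq] at h
  exact Prod.ext (Fin.ext h.1) (Subtype.ext h.2)

theorem mem_positions (y : PosCode) : y ∈ γ.positions ↔ ∃ x, γ.posCode x = y := by
  obtain ⟨q, e⟩ := y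
  simp only [positions, List.mem_flatMap, List.mem_map, mem_colors, Prod.mk.injEq]
  constructor
  · rintro ⟨⟨e', q'⟩, h, e'', he, rfl, rfl⟩
    obtain ⟨q₀, _, rfl⟩ := (γ.mem_stateColors _ _).1 h
    exact ⟨(q₀, ⟨e'', he⟩), rfl⟩
  · rintro ⟨x, h⟩
    simp only [posCode, Prod.mk.injEq] at h
    exact ⟨_, (γ.mem_stateColors _ _).2 ⟨x.1, rfl, rfl⟩, x.2, x.2.2, h.1, h.2⟩

theorem positions_nodup : γ.positions.Nodup := by
  rw [positions, List.nodup_flatMap]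
  refine ⟨fun c _ => γ.colors_nodup.map fun _ _ h => (Prod.mk.inj h).2, ?_⟩
  rw [stateColors_eq, List.pairwise_ofFn]
  intro i j hij
  simp only [Function.onFun, List.disjoint_left, List.mem_map]
  rintro _ ⟨e, _, rfl⟩ ⟨e', _, h⟩
  exact hij.ne' (Fin.ext (Prod.mk.inj h).1)

open Classical in
/-- The code of a set of positions. -/
noncomputable def setCode (X : Set γ.aut.Pos) : List PosCode :=
  γ.positions.filter fun y => decide (∃ x ∈ X, γ.posCode x = y)

theorem mem_setCode {X : Set γ.aut.Pos} {y : PosCode} :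
    y ∈ γ.setCode X ↔ ∃ x ∈ X, γ.posCode x = y := by
  simp only [setCode, List.mem_filter, decide_eq_true_eq, mem_positions, and_iff_right_iff_imp]
  exact fun ⟨x, _, h⟩ => ⟨x, h⟩

theorem posCode_mem_setCode {X : Set γ.aut.Pos} {x : γ.aut.Pos} :
    γ.posCode x ∈ γ.setCode X ↔ x ∈ X := by
  rw [mem_setCode]
  exact ⟨fun ⟨y, hy, h⟩ => γ.posCode_injective h ▸ hy, fun h => ⟨x, h, rfl⟩⟩

theorem setCode_injective : Function.Injective γ.setCode := fun X Y h => by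
  ext x
  rw [← posCode_mem_setCode, h, posCode_mem_setCode]

-- All sets handled by the algorithm arise by filtering `positions`, so each has a single code, and
-- equality of sets can be tested on lists.
open Classical in
theorem setCode_eq {X : Set γ.aut.Pos} {p : PosCode → Bool}
    (h : ∀ x, p (γ.posCode x) = true ↔ x ∈ X) : γ.positions.filter p = γ.setCode X := by
  refine List.filter_congr fun y hy => ?_
  obtain ⟨x, rfl⟩ := (γ.mem_positions y).1 hy
  rw [Bool.eq_iff_iff, h, decide_eq_true_eq]
  exact ⟨fun hx => ⟨x, hx, rfl⟩, fun ⟨y, hy, h⟩ => γ.posCode_injective h ▸ hy⟩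

theorem stepSet_setCode (X : Set γ.aut.Pos) (a : Fin γ.s) :
    γ.stepSet (γ.setCode X) a = γ.setCode (γ.aut.stepP X a) := by
  refine γ.setCode_eq fun y => ?_
  simp only [List.any_eq_true, Bool.and_eq_true, beq_iff_eq, mem_setCode]
  have hmax : ∀ e e' : ℕ, (bif Nat.ble e e' then e' else e) = max e e' := fun e e' => by
    rcases le_or_gt e e' with h | h
    · rw [show Nat.ble e e' = true by rwa [Nat.ble_eq], max_eq_right h]; rfl
    · rw [max_eq_left h.le, show Nat.ble e e' = false by
        rw [← Bool.not_eq_true, Nat.ble_eq]; omega]; rfl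
  have hcoe : ∀ c d : γ.aut.Col, ((max c d : γ.aut.Col) : ℕ) = max (c : ℕ) d := fun c d =>
    (Subtype.mono_coe (· ∈ Set.range γ.aut.color)).map_max
  constructor
  · rintro ⟨_, ⟨x, hx, rfl⟩, ⟨q, a', q'⟩, hτ, h1, h2, h3, ⟨e, q''⟩, hc, h4, h5⟩
    obtain ⟨q₀, a₀, b, rfl, rfl, rfl⟩ := (γ.mem_trans _ _ _).1 hτ
    obtain ⟨q₁, rfl, rfl⟩ := (γ.mem_stateColors _ _).1 hc
    simp only [posCode] at h1 h2 h3 h4 h5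
    obtain rfl := Fin.ext h1
    obtain rfl := Fin.ext h2
    have h3 := Fin.ext h3
    have h4 := Fin.ext h4
    refine ⟨x, hx, b, Prod.ext h3.symm (Subtype.ext ?_)⟩
    rw [hmax] at h5
    simp only [DPA.stepT, hcoe, DPA.colorOf]
    rw [h5, h4, h3]
  · rintro ⟨x, hx, b, rfl⟩
    refine ⟨_, ⟨x, hx, rfl⟩, _, (γ.mem_trans _ _ _).2 ⟨x.1, a, b, rfl, rfl, rfl⟩, rfl, rfl, rfl, _,
      (γ.mem_stateColors _ _).2 ⟨_, rfl, rfl⟩, rfl, ?_⟩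
    rw [hmax]
    simp only [DPA.stepT, posCode, hcoe, DPA.colorOf]

theorem initSet_eq (q : Fin γ.n) : γ.initSet q = γ.setCode {(q, γ.aut.colorOf q)} := by
  refine γ.setCode_eq fun y => ?_
  simp only [Bool.and_eq_true, beq_iff_eq, List.any_eq_true, Set.mem_singleton_iff]
  constructor
  · rintro ⟨h1, c, hc, rfl⟩
    obtain ⟨q₀, h2, h3⟩ := (γ.mem_stateColors _ _).1 hc
    obtain rfl := Fin.ext h3
    exact Prod.ext (Fin.ext h1) (Subtype.ext h2)
  · rintro rfl
    exact ⟨rfl, _, (γ.mem_stateColors _ _).2 ⟨q, rfl, rfl⟩, rfl⟩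

/-- The code of a function from the states to sets of positions. -/
noncomputable def funCode (F : Fin γ.n → Set γ.aut.Pos) : FunCode :=
  List.ofFn fun q => ((q : ℕ), γ.setCode (F q))

theorem value_funCode (F : Fin γ.n → Set γ.aut.Pos) (q : Fin γ.n) :
    (γ.funCode F).value q = γ.setCode (F q) := by
  have := flatMap_cond (List.nodup_finRange γ.n) (List.mem_finRange q) fun q => γ.setCode (F q)
  rw [← this, FunCode.value, funCode, List.ofFn_eq_map, List.flatMap_map]
  congr 1
  funext p
  by_cases h : p = q
  · simp [h]
  · simp [h, beq_eq_false_iff_ne.2 (Fin.val_ne_of_ne h)]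

theorem initFun_eq : γ.initFun = γ.funCode fun q => {(q, γ.aut.colorOf q)} := by
  simp only [initFun, stateColors_eq, List.map_ofFn, funCode, Function.comp_def, initSet_eq]

theorem stepFun_funCode (F : Fin γ.n → Set γ.aut.Pos) (a : Fin γ.s) :
    γ.stepFun (γ.funCode F) a = γ.funCode fun q => γ.aut.stepP (F q) a := by
  simp only [stepFun, funCode, List.map_ofFn, Function.comp_def, stepSet_setCode]

/-- The code of the function that is realized by a word. -/
noncomputable def wordCode (w : List (Fin γ.s)) : FunCode :=
  γ.funCode fun q => γ.aut.stepPStar {(q, γ.aut.colorOf q)} w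

theorem stepFun_wordCode (w : List (Fin γ.s)) (a : Fin γ.s) :
    γ.stepFun (γ.wordCode w) a = γ.wordCode (w ++ [a]) := by
  simp only [wordCode, stepFun_funCode, DPA.stepPStar, List.foldl_append, List.foldl_cons,
    List.foldl_nil]

/-- The functions that are realized by words of length `j`. -/
def layerAt (j : ℕ) : List FunCode :=
  (List.replicate j ()).foldl (fun L _ => γ.stepLayer L) [γ.initFun]

theorem layerAt_succ (j : ℕ) : γ.layerAt (j + 1) = γ.stepLayer (γ.layerAt j) := by
  rw [layerAt, List.replicate_succ', List.foldl_append]; rfl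

/-- The function of `w ++ [a]` is determined by `a` and the function of `w`, so one word per
function is enough and duplicates can be dropped. -/
theorem mem_layerAt (j : ℕ) (f : FunCode) :
    f ∈ γ.layerAt j ↔ ∃ w, w.length = j ∧ f = γ.wordCode w := by
  induction j generalizing f with
  | zero =>
    simp only [layerAt, List.replicate_zero, List.foldl_nil, List.mem_singleton, initFun_eq,
      List.length_eq_zero_iff, exists_eq_left]
    rfl
  | succ j ih =>
    simp only [layerAt_succ, stepLayer, mem_nub, List.mem_flatMap, List.mem_map, ih, mem_letters]
    constructor
    · rintro ⟨_, ⟨w, hw, rfl⟩, _, ⟨a, rfl⟩, rfl⟩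
      exact ⟨w ++ [a], by simp [hw], γ.stepFun_wordCode w a⟩
    · rintro ⟨w, hw, rfl⟩
      obtain ⟨w, a, rfl⟩ : ∃ w' a, w = w' ++ [a] := by
        rcases List.eq_nil_or_concat w with rfl | ⟨w', a, rfl⟩
        · simp at hw
        · exact ⟨w', a, by simp⟩
      exact ⟨_, ⟨w, by simpa using hw, rfl⟩, _, ⟨a, rfl⟩, γ.stepFun_wordCode w a⟩

theorem layerAt_nodup (j : ℕ) : (γ.layerAt j).Nodup := by
  cases j with
  | zero => exact List.nodup_singleton _
  | succ j => rw [layerAt_succ]; exact nodup_nub _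

/-- The code of a partial function. -/
noncomputable def behaviorCode (r : γ.aut.PartialFun) : BehCode :=
  (γ.setCode (DPA.dom r)).map fun y =>
    (y, γ.setCode {z | ∃ x X, γ.posCode x = y ∧ r x = some X ∧ z ∈ X})

theorem map_fst_behaviorCode (r : γ.aut.PartialFun) :
    (γ.behaviorCode r).map Prod.fst = γ.setCode (DPA.dom r) := by
  simp [behaviorCode, Function.comp_def]

theorem mem_behaviorCode {r : γ.aut.PartialFun} {y : PosCode} {L : List PosCode} :
    (y, L) ∈ γ.behaviorCode r ↔ ∃ x X, r x = some X ∧ γ.posCode x = y ∧ γ.setCode X = L := by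
  have hset : ∀ x X, r x = some X →
      {z | ∃ x' X', γ.posCode x' = γ.posCode x ∧ r x' = some X' ∧ z ∈ X'} = X := fun x X hX => by
    ext z
    constructor
    · rintro ⟨x', X', h1, h2, h3⟩
      obtain rfl := γ.posCode_injective h1
      rw [hX] at h2
      exact Option.some.inj h2 ▸ h3
    · exact fun hz => ⟨x, X, rfl, hX, hz⟩
  simp only [behaviorCode, List.mem_map, mem_setCode, Prod.mk.injEq]
  constructor
  · rintro ⟨_, ⟨x, hx, rfl⟩, rfl, rfl⟩
    obtain ⟨X, hX⟩ := Option.isSome_iff_exists.1 hx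
    exact ⟨x, X, hX, rfl, by rw [hset x X hX]⟩
  · rintro ⟨x, X, hX, rfl, rfl⟩
    exact ⟨_, ⟨x, by simp [DPA.dom, hX], rfl⟩, rfl, by rw [hset x X hX]⟩

theorem behaviorCode_injective : Function.Injective γ.behaviorCode := fun r r' h => by
  have key : ∀ {r r' : γ.aut.PartialFun}, γ.behaviorCode r = γ.behaviorCode r' →
      ∀ x X, r x = some X → r' x = some X := fun {r r'} h x X hX => by
    have := γ.mem_behaviorCode.2 ⟨x, X, hX, rfl, rfl⟩
    rw [h, mem_behaviorCode] at this
    obtain ⟨x', X', h1, h2, h3⟩ := this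
    rwa [γ.posCode_injective h2, γ.setCode_injective h3] at h1
  funext x
  cases hx : r x with
  | some X => exact (key h x X hx).symm
  | none =>
    cases hx' : r' x with
    | none => rfl
    | some X => rw [key h.symm x X hx'] at hx; simp at hx

/-- A behavior depends on a position only through its state, so it can be tabulated from a function
on the states. -/
theorem behaviorCode_behavior (D : Set γ.aut.Pos) (w : List (Fin γ.s)) :
    γ.behaviorCode (γ.aut.behavior D w) =
      (γ.setCode D).map fun y => (y, (γ.wordCode w).value y.1) := by
  rw [behaviorCode, DPA.dom_behavior]
  refine List.map_congr_left fun y hy => ?_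
  obtain ⟨x, hx, rfl⟩ := γ.mem_setCode.1 hy
  rw [posCode, wordCode, value_funCode]
  congr 2
  ext z
  constructor
  · rintro ⟨x', X', h1, h2, h3⟩
    obtain rfl := γ.posCode_injective h1
    simp only [DPA.behavior, hx, if_true, Option.some.injEq] at h2
    exact h2 ▸ h3
  · exact fun hz => ⟨x, _, rfl, by simp [DPA.behavior, hx], hz⟩

theorem mem_sublists'_positions (D : List PosCode) :
    D ∈ γ.positions.sublists' ↔ ∃ X, D = γ.setCode X := by
  rw [List.mem_sublists']
  constructor
  · intro h
    refine ⟨{x | γ.posCode x ∈ D}, ?_⟩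
    rw [← γ.setCode_eq (p := fun y => decide (y ∈ D)) (by simp)]
    convert eq_filter_of_sublist γ.positions_nodup h
  · rintro ⟨X, rfl⟩
    exact List.filter_sublist

theorem setCode_eq_nil {X : Set γ.aut.Pos} : γ.setCode X = [] ↔ X = ∅ := by
  rw [List.eq_nil_iff_forall_not_mem, Set.eq_empty_iff_forall_notMem]
  exact ⟨fun h x hx => h _ (γ.posCode_mem_setCode.2 hx),
    fun h y hy => by obtain ⟨x, hx, _⟩ := γ.mem_setCode.1 hy; exact h x hx⟩

theorem mem_behaviorList (c : BehCode) :
    c ∈ γ.behaviorList ↔ ∃ r ∈ γ.aut.behaviors γ.k, γ.behaviorCode r = c := by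
  have hl : ∀ f, f ∈ γ.layer ↔ ∃ w, w.length = γ.k ∧ f = γ.wordCode w := γ.mem_layerAt γ.k
  simp only [behaviorList, positionSets, mem_nub, List.mem_flatMap, mem_sublists'_positions]
  constructor
  · rintro ⟨_, ⟨X, rfl⟩, h⟩
    cases hX : γ.setCode X == [] <;> rw [hX] at h
    · simp only [cond_false, List.mem_map, hl] at h
      obtain ⟨_, ⟨w, hw, rfl⟩, rfl⟩ := h
      have hne : X.Nonempty := by
        rw [Set.nonempty_iff_ne_empty]
        rintro rfl
        rw [γ.setCode_eq_nil.2 rfl] at hX; simp at hX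
      exact ⟨_, ⟨w, X, hw, hne, rfl⟩, γ.behaviorCode_behavior X w⟩
    · simp at h
  · rintro ⟨_, ⟨w, X, hw, hne, rfl⟩, rfl⟩
    refine ⟨_, ⟨X, rfl⟩, ?_⟩
    have : (γ.setCode X == []) = false := by
      rw [← Bool.not_eq_true, beq_iff_eq, setCode_eq_nil]; exact hne.ne_empty
    rw [this]
    simp only [cond_false, List.mem_map, hl]
    exact ⟨_, ⟨w, hw, rfl⟩, (γ.behaviorCode_behavior X w).symm⟩

theorem behaviorList_nodup : γ.behaviorList.Nodup := nodup_nub _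

/-- The code of a vertex. -/
noncomputable def vertexCode : γ.aut.Vertex γ.k → VertexCode
  | .start => ((false, false), ([], (0, 0)))
  | .pair r x => ((false, true), (γ.behaviorCode r, γ.posCode x))
  | .fn r => ((true, false), (γ.behaviorCode r, (0, 0)))

theorem vertexCode_injective : Function.Injective γ.vertexCode := by
  intro v v' h
  cases v <;> cases v' <;> simp only [vertexCode, Prod.mk.injEq, reduceCtorEq, and_false, and_true,
    false_and, true_and] at h ⊢
  · obtain ⟨h1, h2⟩ := h
    rw [Subtype.ext (γ.behaviorCode_injective h1), γ.posCode_injective h2]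
  · rw [Subtype.ext (γ.behaviorCode_injective h)]

theorem mem_vertexList (c : VertexCode) : c ∈ γ.vertexList ↔ ∃ v, γ.vertexCode v = c := by
  simp only [vertexList, List.mem_cons, List.mem_append, List.mem_map, List.mem_flatMap,
    mem_behaviorList, mem_positions]
  constructor
  · rintro (rfl | ⟨_, ⟨r, hr, rfl⟩, rfl⟩ | ⟨_, ⟨r, hr, rfl⟩, _, ⟨x, rfl⟩, rfl⟩)
    · exact ⟨.start, rfl⟩
    · exact ⟨.fn ⟨r, hr⟩, rfl⟩
    · exact ⟨.pair ⟨r, hr⟩ x, rfl⟩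
  · rintro ⟨v, rfl⟩
    cases v with
    | start => exact .inl rfl
    | fn r => exact .inr (.inl ⟨_, ⟨r.1, r.2, rfl⟩, rfl⟩)
    | pair r x => exact .inr (.inr ⟨_, ⟨r.1, r.2, rfl⟩, _, ⟨x, rfl⟩, rfl⟩)

theorem vertexList_nodup : γ.vertexList.Nodup := by
  rw [vertexList, List.nodup_cons, List.nodup_append]
  refine ⟨by simp, γ.behaviorList_nodup.map fun _ _ h => by simpa using h, ?_, ?_⟩
  · rw [List.nodup_flatMap]
    refine ⟨fun r _ => γ.positions_nodup.map fun _ _ h => by simpa using h,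
      γ.behaviorList_nodup.imp fun h => ?_⟩
    simp only [Function.onFun, List.disjoint_left, List.mem_map]
    rintro _ ⟨x, _, rfl⟩ ⟨y, _, h'⟩
    simp only [Prod.mk.injEq] at h'
    exact h h'.2.1.symm
  · simp only [List.mem_map, List.mem_flatMap]
    rintro _ ⟨r, _, rfl⟩ _ ⟨r', _, x, _, rfl⟩ h
    simp at h

theorem vertexColor_vertexCode (v : γ.aut.Vertex γ.k) :
    γ.vertexColor (γ.vertexCode v) = (γ.aut.arena γ.k).color v := by
  cases v <;> first | rfl | exact γ.minColor_eq

theorem owner_vertexCode (v : γ.aut.Vertex γ.k) :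
    (γ.vertexCode v).1.1 = true ↔ (γ.aut.arena γ.k).owner v = .O := by
  cases v <;> simp [vertexCode, DPA.arena]

theorem edge_vertexCode (v v' : γ.aut.Vertex γ.k) :
    γ.edge (γ.vertexCode v) (γ.vertexCode v') = true ↔ (γ.aut.arena γ.k).edge v v' := by
  cases v <;> cases v' <;> simp only [vertexCode, edge, DPA.arena, map_fst_behaviorCode, Bool.not_true, Bool.not_false,
    Bool.true_and, Bool.and_false, Bool.false_and, Bool.or_false, Bool.false_or, cond_true, cond_false,
    Bool.false_eq_true]
  · rename_i r
    rw [beq_iff_eq, initState, initSet_eq, γ.setCode_injective.eq_iff]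
  · rename_i r x r'
    simp only [List.any_eq_true, Bool.and_eq_true, beq_iff_eq]
    constructor
    · rintro ⟨⟨y, L⟩, h, rfl, rfl⟩
      obtain ⟨x', X, h1, h2, h3⟩ := γ.mem_behaviorCode.1 h
      rwa [γ.posCode_injective h2, γ.setCode_injective h3] at h1
    · exact fun h => ⟨_, γ.mem_behaviorCode.2 ⟨x, _, h, rfl, rfl⟩, rfl, rfl⟩
  · rename_i r r' x
    simp only [Bool.and_eq_true, beq_iff_eq, γ.behaviorCode_injective.eq_iff, Subtype.ext_iff]
    refine and_congr_right fun _ => ?_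
    rw [← posCode_mem_setCode, ← map_fst_behaviorCode]
    simp

end Input
end DelayGame

namespace DelayGame
open Enc

/-! ### Bounds for the size of the arena -/

namespace Input

variable (γ : Input)

theorem n_pos : 0 < γ.n := γ.aut.init.pos

theorem length_colors_le : γ.colors.length ≤ γ.n := by
  have := (List.subperm_of_subset γ.colors_nodup (l₂ := γ.colorTable) fun x hx =>
    ((sortColors_spec _).2 x).1 hx).length_le
  simpa [colorTable] using this

theorem length_positions_le : γ.positions.length ≤ γ.n ^ 2 := by
  have h : γ.positions.length = γ.n * γ.colors.length := by
    simp [positions, stateColors_eq, List.length_flatMap, Function.comp_def, List.ofFn_const]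
  rw [h, sq]
  exact Nat.mul_le_mul_left _ γ.length_colors_le

theorem numColors_le : γ.aut.numColors ≤ γ.n := by
  have := Set.ncard_image_le (f := γ.aut.color) (Set.finite_univ)
  simpa [DPA.numColors, Set.ncard_univ] using this

/-- The layer has no duplicates and codes functions from `n` states to subsets of at most `n ^ 2`
positions, independently of `j` and of the alphabets. -/
theorem length_layerAt_le (j : ℕ) : (γ.layerAt j).length ≤ 2 ^ γ.n ^ 3 := by
  classical
  have h1 : (γ.layerAt j).toFinset ⊆ Finset.univ.image γ.funCode := fun f hf => by
    obtain ⟨w, _, rfl⟩ := (γ.mem_layerAt j f).1 (List.mem_toFinset.1 hf)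
    exact Finset.mem_image_of_mem _ (Finset.mem_univ _)
  have h2 := (Finset.card_le_card h1).trans Finset.card_image_le
  rw [List.toFinset_card_of_nodup (γ.layerAt_nodup j), Finset.card_univ, Fintype.card_fun,
    Fintype.card_set, Fintype.card_prod, Fintype.card_fin, ← pow_mul] at h2
  refine h2.trans (Nat.pow_le_pow_right (by norm_num) ?_)
  have h3 : Fintype.card γ.aut.Col ≤ γ.n := by
    simpa using Fintype.card_range_le γ.aut.color
  calc γ.n * Fintype.card γ.aut.Col * γ.n ≤ γ.n * γ.n * γ.n := by gcongr
    _ = γ.n ^ 3 := by ring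

theorem length_behaviorList_le : γ.behaviorList.length ≤ 2 ^ (2 * γ.n ^ 3) := by
  have h1 : γ.behaviorList.length ≤ γ.positionSets.length * γ.layer.length := by
    refine (List.subperm_of_subset γ.behaviorList_nodup
      fun x hx => mem_nub.1 hx).length_le.trans ?_
    rw [List.length_flatMap]
    refine (List.sum_le_card_nsmul _ γ.layer.length ?_).trans (by simp)
    simp only [List.mem_map]
    rintro _ ⟨D, _, rfl⟩
    cases D == [] <;> simp
  have h2 : γ.positionSets.length ≤ 2 ^ γ.n ^ 2 := by
    rw [positionSets, List.length_sublists']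
    exact Nat.pow_le_pow_right (by norm_num) γ.length_positions_le
  have h3 : γ.layer.length ≤ 2 ^ γ.n ^ 3 := γ.length_layerAt_le γ.k
  calc γ.behaviorList.length ≤ 2 ^ γ.n ^ 2 * 2 ^ γ.n ^ 3 := h1.trans (Nat.mul_le_mul h2 h3)
    _ = 2 ^ (γ.n ^ 2 + γ.n ^ 3) := (pow_add ..).symm
    _ ≤ 2 ^ (2 * γ.n ^ 3) := Nat.pow_le_pow_right (by norm_num) (by
      have := Nat.pow_le_pow_right γ.n_pos (show 2 ≤ 3 by norm_num); omega)

theorem length_vertexList_le : γ.vertexList.length ≤ 2 ^ (5 * γ.n ^ 3) := by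
  have h1 : γ.vertexList.length =
      γ.behaviorList.length + γ.behaviorList.length * γ.positions.length + 1 := by
    simp [vertexList, List.length_flatMap]
  have h2 := γ.length_behaviorList_le
  have h3 := γ.length_positions_le
  have h4 : γ.n ^ 2 ≤ γ.n ^ 3 := Nat.pow_le_pow_right γ.n_pos (by norm_num)
  have h5 : 1 ≤ γ.n ^ 3 := Nat.one_le_pow _ _ γ.n_pos
  have h6 : γ.positions.length < 2 ^ γ.n ^ 3 := (h3.trans h4).trans_lt Nat.lt_two_pow_self
  have h7 : 1 ≤ 2 ^ (2 * γ.n ^ 3) := Nat.one_le_two_pow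
  have h8 : 2 ≤ 2 ^ γ.n ^ 3 := by
    calc 2 = 2 ^ 1 := rfl
      _ ≤ _ := Nat.pow_le_pow_right (by norm_num) h5
  calc γ.vertexList.length ≤ 2 ^ (2 * γ.n ^ 3) * (2 ^ γ.n ^ 3 * 2) := by
        rw [h1]
        have := Nat.mul_le_mul h2 h6.le
        nlinarith
    _ ≤ 2 ^ (2 * γ.n ^ 3) * (2 ^ γ.n ^ 3 * 2 ^ γ.n ^ 3) := by gcongr
    _ = 2 ^ (4 * γ.n ^ 3) := by rw [← pow_add, ← pow_add]; ring_nf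
    _ ≤ _ := Nat.pow_le_pow_right (by norm_num) (by omega)

/-! ### The algorithm runs in polynomial time with respect to the weight of the input -/

theorem polyBd_two_pow : PolyBd fun γ : Input => 2 ^ γ.n ^ 4 :=
  PolyBd.wt_self.mono fun γ => Nat.le_add_left _ ((encodeInput γ.aut γ.k).size + 1)

theorem polyBd_two_pow_cube (m : ℕ) : PolyBd fun γ : Input => 2 ^ (m * γ.n ^ 3) :=
  (polyBd_two_pow.pow m).mono fun γ => by
    rw [← pow_mul, mul_comm]
    exact Nat.pow_le_pow_right (by norm_num)
      (Nat.mul_le_mul_right _ (Nat.pow_le_pow_right γ.n_pos (by norm_num)))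

/-- As `c ≤ n`, the exponent `n ^ 2 * c + 1` is at most `2 * n ^ 3`. Hence the loop over the letters
can be driven by a unary counter. -/
theorem polyBd_k : PolyBd Input.k :=
  (polyBd_two_pow_cube 2).mono fun γ => γ.k_le.trans <|
    Nat.pow_le_pow_right (by norm_num) <| by
      have h1 := Nat.mul_le_mul_left (γ.n ^ 2) γ.numColors_le
      have h2 : γ.n ^ 2 * γ.n = γ.n ^ 3 := (pow_succ ..).symm
      have h3 : 1 ≤ γ.n ^ 3 := Nat.one_le_pow _ _ γ.n_pos
      omega

theorem polyBd_n : PolyBd Input.n :=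
  polyBd_two_pow.mono fun γ => by
    have h1 : γ.n ≤ γ.n ^ 4 := Nat.le_self_pow (by norm_num) _
    have h2 := Nat.lt_two_pow_self (n := γ.n ^ 4)
    omega

theorem wt_layerAt_le (j : ℕ) : wt (γ.layerAt j) ≤
    2 + 2 ^ (1 * γ.n ^ 3) * (2 + γ.n * ((4 * γ.n + 2) + wt γ.positions)) := by
  refine wt_list_le ((γ.length_layerAt_le j).trans (by rw [one_mul])) fun f hf => ?_
  obtain ⟨w, _, rfl⟩ := (γ.mem_layerAt j f).1 hf
  refine wt_list_le (by simp [wordCode, funCode]) fun p hp => ?_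
  rw [wordCode, funCode, List.mem_ofFn] at hp
  obtain ⟨q, rfl⟩ := hp
  have h1 := wt_nat_le q
  have h2 := q.2
  have h3 : wt (γ.setCode (γ.aut.stepPStar {(q, γ.aut.colorOf q)} w)) ≤ wt γ.positions :=
    wt_le_of_sublist List.filter_sublist
  rw [wt_prod]
  omega

-- The intermediate values are the layers for smaller lengths, which obey the same bound.
@[fun_prop] theorem poly_layer : Poly layer := by
  unfold layer
  refine Poly.foldl (g := fun γ L _ => stepLayer γ L) (by fun_prop) (by fun_prop)
    (Poly.replicate poly_k polyBd_k)
    (((PolyBd.const 2).add ((polyBd_two_pow_cube 1).mul ((PolyBd.const 2).add (polyBd_n.mul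
      ((((PolyBd.const 4).mul polyBd_n).add (.const 2)).add poly_positions.wt_bd))))))
    fun γ l h => ?_
  have hl : l = List.replicate l.length () := List.eq_replicate_iff.2 ⟨rfl, fun _ _ => rfl⟩
  rw [hl]
  exact γ.wt_layerAt_le l.length

@[fun_prop] theorem poly_positionSets : Poly positionSets :=
  Poly.sublists' poly_positions <| (polyBd_two_pow_cube 1).mono fun γ =>
    Nat.pow_le_pow_right (by norm_num) <| γ.length_positions_le.trans <| by
      rw [one_mul]; exact Nat.pow_le_pow_right γ.n_pos (by norm_num)

@[fun_prop] theorem poly_behaviorList : Poly behaviorList := by unfold behaviorList; fun_prop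

@[fun_prop] theorem poly_vertexList : Poly vertexList := by unfold vertexList; fun_prop

@[fun_prop] theorem poly_coloredVertices : Poly coloredVertices := by
  unfold coloredVertices; fun_prop

section
variable {α : Type} [Enc α]

@[fun_prop] theorem poly_edge {γ : α → Input} {v v' : α → VertexCode}
    (hγ : Poly γ) (hv : Poly v) (hv' : Poly v') : Poly fun a => (γ a).edge (v a) (v' a) := by
  unfold edge; fun_prop

@[fun_prop] theorem poly_vertexColor {γ : α → Input} {v : α → VertexCode}
    (hγ : Poly γ) (hv : Poly v) : Poly fun a => (γ a).vertexColor (v a) := by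
  unfold vertexColor; fun_prop

@[fun_prop] theorem poly_canForce {γ : α → Input} {Z : α → List (ℕ × VertexCode)}
    {v : α → VertexCode} (hγ : Poly γ) (hZ : Poly Z) (hv : Poly v) :
    Poly fun a => (γ a).canForce (Z a) (v a) := by
  unfold canForce; fun_prop

@[fun_prop] theorem poly_exec {γ : α → Input} {st : α → List (ℕ × VertexCode) × List VertexCode}
    {i : α → (Bool × Bool) × ℕ} (hγ : Poly γ) (hst : Poly st) (hi : Poly i) :
    Poly fun a => (γ a).exec (st a) (i a) := by
  unfold exec; fun_prop

end

/-- The nested loops are unrolled into one list. With `N ≥ 1` vertices, one more color turns length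
`L ≥ 1` into `N * (L + 1) + 1 ≤ 3 * N * L`. -/
theorem length_instrs_le (cs : List ℕ) :
    (γ.instrs cs).length ≤ (3 * γ.vertexList.length) ^ cs.length := by
  have h1 : 1 ≤ γ.vertexList.length := by simp [vertexList]
  induction cs with
  | nil => simp [instrs]
  | cons i cs ih =>
    have : (γ.instrs (i :: cs)).length =
        γ.vertexList.length * ((γ.instrs cs).length + 1) + 1 := by
      simp [instrs, List.length_flatMap]
    rw [this, List.length_cons, pow_succ]
    have h2 : 1 ≤ (3 * γ.vertexList.length) ^ cs.length := Nat.one_le_pow _ _ (by omega)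
    nlinarith [Nat.mul_le_mul_left γ.vertexList.length ih,
      Nat.mul_le_mul_left γ.vertexList.length h2]

theorem mem_instrs {cs : List ℕ} {i : (Bool × Bool) × ℕ} (h : i ∈ γ.instrs cs) :
    i.2 = 0 ∨ i.2 ∈ cs := by
  induction cs with
  | nil => simp only [instrs, List.foldr_nil, List.mem_singleton] at h; simp [h]
  | cons c cs ih =>
    have : γ.instrs (c :: cs) = ((true, true), c) :: γ.vertexList.flatMap fun _ =>
      γ.instrs cs ++ [((true, false), c)] := rfl
    simp only [this, List.mem_cons, List.mem_flatMap, List.mem_append, List.not_mem_nil,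
      or_false] at h
    rcases h with rfl | ⟨_, _, h | rfl⟩
    · simp
    · exact (ih h).imp_right (List.mem_cons_of_mem _)
    · simp

@[fun_prop] theorem poly_instrs_colors : Poly fun γ : Input => γ.instrs γ.colors := by
  -- The power `(3 * N) ^ n` with `N ≤ 2 ^ (5 * n ^ 3)` is at most `2 ^ (7 * n ^ 4)`.
  have hbd : PolyBd fun γ : Input => (3 * γ.vertexList.length) ^ γ.n :=
    (polyBd_two_pow.pow 7).mono fun γ => by
      have h1 := γ.length_vertexList_le
      have h2 : 1 ≤ γ.n ^ 3 := Nat.one_le_pow _ _ γ.n_pos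
      calc (3 * γ.vertexList.length) ^ γ.n ≤ (2 ^ 2 * 2 ^ (5 * γ.n ^ 3)) ^ γ.n :=
            Nat.pow_le_pow_left (Nat.mul_le_mul (by norm_num) h1) _
        _ = 2 ^ ((2 + 5 * γ.n ^ 3) * γ.n) := by rw [← pow_add, ← pow_mul]
        _ ≤ 2 ^ ((7 * γ.n ^ 3) * γ.n) := by gcongr; norm_num; omega
        _ = (2 ^ γ.n ^ 4) ^ 7 := by rw [← pow_mul]; ring_nf
  unfold instrs
  refine Poly.foldr (g := fun (γ : Input) i I => ((true, true), i) :: γ.vertexList.flatMap fun _ =>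
      I ++ [((true, false), i)]) (by fun_prop) (by fun_prop) (by fun_prop)
    (W := fun γ : Input => 2 + (3 * γ.vertexList.length) ^ γ.n * (4 + 4 + (2 + wt γ.colors)))
    ((PolyBd.const 2).add (hbd.mul ((PolyBd.const 8).add
      ((PolyBd.const 2).add poly_colors.wt_bd)))) fun γ l h => ?_
  refine wt_list_le ((γ.length_instrs_le l).trans (Nat.pow_le_pow_right ?_ ?_)) fun i hi => ?_
  · have : 1 ≤ γ.vertexList.length := by simp [vertexList]
    omega
  · exact h.length_le.trans γ.length_colors_le
  · obtain ⟨⟨b, b'⟩, m⟩ := i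
    have h1 := wt_bool_le b
    have h2 := wt_bool_le b'
    have h3 : wt m ≤ 2 + wt γ.colors := by
      rcases γ.mem_instrs hi with h' | h'
      · simp only at h'; rw [h']; exact Nat.le_add_right _ _
      · exact (wt_le_of_mem (h.subset h')).trans (Nat.le_add_left _ _)
    simp only [wt_prod]
    omega

/-- Both components are always obtained by filtering fixed lists, so the state cannot grow during
the computation. -/
theorem exec_sublist (l : List ((Bool × Bool) × ℕ))
    (st : List (ℕ × VertexCode) × List VertexCode) (h1 : st.1.Sublist γ.coloredVertices)
    (h2 : st.2.Sublist γ.vertexList) : (l.foldl γ.exec st).1.Sublist γ.coloredVertices ∧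
      (l.foldl γ.exec st).2.Sublist γ.vertexList := by
  induction l generalizing st with
  | nil => exact ⟨h1, h2⟩
  | cons i l ih =>
    refine ih _ ?_ ?_ <;> unfold exec <;> cases i.1.1 <;>
      first | exact h1 | exact h2 | exact List.filter_sublist

@[fun_prop] theorem poly_winRegion : Poly winRegion := by
  unfold winRegion
  refine .comp .snd (Poly.foldl (g := fun γ st i => exec γ st i) (by fun_prop) (by fun_prop)
    (by fun_prop) (poly_coloredVertices.wt_bd.add poly_vertexList.wt_bd) fun γ l _ => ?_)
  obtain ⟨h1, h2⟩ := γ.exec_sublist l ([], []) (List.nil_sublist _) (List.nil_sublist _)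
  exact Nat.add_le_add (wt_le_of_sublist h1) (wt_le_of_sublist h2)

theorem poly_output : Poly output := by
  unfold output winnerIsO; fun_prop

end Input
end DelayGame

namespace DelayGame
open Enc

/-! ### Correctness of the fixed point computation -/

theorem foldl_flatMap_const {β δ ε : Type*} (f : δ → ε → δ) (l : List β) (K : List ε) (st : δ) :
    (l.flatMap fun _ => K).foldl f st = (fun st => K.foldl f st)^[l.length] st := by
  induction l generalizing st with
  | nil => rfl
  | cons x l ih => rw [List.flatMap_cons, List.foldl_append, ih]; rfl

namespace Input

open ParityGame

variable (γ : Input)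

theorem color_mem_colors (v : γ.aut.Vertex γ.k) : (γ.aut.arena γ.k).color v ∈ γ.colors := by
  rw [mem_colors]
  cases v with
  | pair r x => exact x.2.2
  | _ => exact Nat.sInf_mem ⟨_, γ.aut.init, rfl⟩

/-- The state of the computation represents the sets `Z c` and the last result `X`. -/
def Represents (st : List (ℕ × VertexCode) × List VertexCode) (Z : ℕ → Set (γ.aut.Vertex γ.k))
    (X : Set (γ.aut.Vertex γ.k)) : Prop :=
  (∀ c ∈ γ.colors, ∀ v, (c, γ.vertexCode v) ∈ st.1 ↔ v ∈ Z c) ∧ ∀ v, γ.vertexCode v ∈ st.2 ↔ v ∈ X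

variable {γ}

theorem mem_coloredVertices (c : ℕ) (v : γ.aut.Vertex γ.k) :
    (c, γ.vertexCode v) ∈ γ.coloredVertices ↔ c ∈ γ.colors := by
  simp only [coloredVertices, List.mem_flatMap, List.mem_map, Prod.mk.injEq]
  constructor
  · rintro ⟨_, h, _, _, rfl, _⟩
    exact h
  · exact fun h => ⟨c, h, _, (γ.mem_vertexList _).2 ⟨v, rfl⟩, rfl, rfl⟩

variable {st : List (ℕ × VertexCode) × List VertexCode} {Z : ℕ → Set (γ.aut.Vertex γ.k)}
  {X : Set (γ.aut.Vertex γ.k)}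

theorem Represents.canForce (h : γ.Represents st Z X) (v : γ.aut.Vertex γ.k) :
    γ.canForce st.1 (γ.vertexCode v) = true ↔
      v ∈ (γ.aut.arena γ.k).pre .O (Z ((γ.aut.arena γ.k).color v)) := by
  have hZ := h.1 _ (γ.color_mem_colors v)
  have hO := γ.owner_vertexCode v
  simp only [Input.canForce, pre, Set.mem_ofPred_eq, ne_eq, ← hO, vertexColor_vertexCode]
  cases (γ.vertexCode v).1.1
  · simp only [cond_false, List.all_eq_true, Bool.or_eq_true, Bool.not_eq_true', List.any_eq_true,
      beq_iff_eq, exists_eq_right, mem_vertexList, ← Bool.not_eq_true]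
    constructor
    · refine fun H => ⟨by simp, fun _ u hu => ?_⟩
      rcases H _ ⟨u, rfl⟩ with h' | h'
      · exact absurd ((γ.edge_vertexCode v u).2 hu) h'
      · exact (hZ u).1 h'
    · rintro H _ ⟨u, rfl⟩
      rw [or_iff_not_imp_left, not_not]
      exact fun hu => (hZ u).2 (H.2 (by simp) u ((γ.edge_vertexCode v u).1 hu))
  · simp only [cond_true, List.any_eq_true, Bool.and_eq_true, beq_iff_eq, exists_eq_right,
      mem_vertexList]
    constructor
    · rintro ⟨_, ⟨u, rfl⟩, hu, h'⟩
      exact ⟨fun _ => ⟨u, (γ.edge_vertexCode v u).1 hu, (hZ u).1 h'⟩, by simp⟩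
    · intro H
      obtain ⟨u, hu, h'⟩ := H.1 (by simp)
      exact ⟨_, ⟨u, rfl⟩, (γ.edge_vertexCode v u).2 hu, (hZ u).2 h'⟩

theorem Represents.compute (h : γ.Represents st Z X) (N : ℕ) :
    γ.Represents (γ.exec st ((false, false), 0)) Z ((γ.aut.arena γ.k).solve .O N [] Z) := by
  refine ⟨h.1, fun v => ?_⟩
  simp only [exec, cond_false, List.mem_filter, h.canForce]
  exact and_iff_right ((γ.mem_vertexList _).2 ⟨v, rfl⟩)

theorem Represents.assign (h : γ.Represents st Z X) (i : ℕ) :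
    γ.Represents (γ.exec st ((true, false), i)) (Function.update Z i X) X := by
  refine ⟨fun c hc v => ?_, h.2⟩
  simp only [exec, cond_true, cond_false, List.mem_filter, mem_coloredVertices, hc, true_and]
  by_cases hci : c = i
  · subst hci; simp [h.2]
  · rw [beq_eq_false_iff_ne.2 hci, Function.update_of_ne hci]
    simp [h.1 c hc]

theorem Represents.reset (h : γ.Represents st Z X) (i : ℕ) :
    γ.Represents (γ.exec st ((true, true), i)) (Function.update Z i {_v | Good .O i}) X := by
  refine ⟨fun c hc v => ?_, h.2⟩
  simp only [exec, cond_true, List.mem_filter, mem_coloredVertices, hc, true_and]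
  by_cases hci : c = i
  · subst hci
    have : c.bodd = false ↔ Even c := by
      rw [Nat.even_iff, Nat.mod_two_of_bodd]; cases c.bodd <;> simp
    simp [Good, this]
  · rw [beq_eq_false_iff_ne.2 hci, Function.update_of_ne hci]
    simp [h.1 c hc]

/-- Only the sets for the colors in `cs` are changed. The inner computation leaves the set for `i`
intact, and by `solve_congr` it is not affected by what earlier rounds left behind for the colors in
`cs`. -/
theorem Represents.foldl_instrs (h : γ.Represents st Z X) (cs : List ℕ) :
    ∃ Z', γ.Represents ((γ.instrs cs).foldl γ.exec st) Z'
      ((γ.aut.arena γ.k).solve .O γ.vertexList.length cs Z) ∧ ∀ c, c ∉ cs → Z' c = Z c := by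
  induction cs generalizing st Z X with
  | nil => exact ⟨Z, h.compute _, fun _ _ => rfl⟩
  | cons i cs ih =>
    set N := γ.vertexList.length with hN
    set f : Set (γ.aut.Vertex γ.k) → Set (γ.aut.Vertex γ.k) :=
      fun X => (γ.aut.arena γ.k).solve .O N cs (Function.update Z i X) with hf
    set body := fun st => (γ.instrs cs ++ [((true, false), i)]).foldl γ.exec st with hbody
    -- Before the first round the last result is a leftover, so it is described for `0 < j` only;
    -- there is at least one round because the arena has an initial vertex.
    have loop : ∀ j, ∃ Z' X', γ.Represents (body^[j] (γ.exec st ((true, true), i))) Z' X' ∧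
        (0 < j → X' = f^[j] {_v | Good .O i}) ∧ Z' i = f^[j] {_v | Good .O i} ∧
        ∀ c, c ∉ i :: cs → Z' c = Z c := fun j => by
      induction j with
      | zero =>
        refine ⟨_, X, h.reset i, by simp, by simp, fun c hc => ?_⟩
        simp only [List.mem_cons, not_or] at hc
        exact Function.update_of_ne hc.1 _ _
      | succ j ihj =>
        obtain ⟨Z₁, X₁, hrep, -, hi, hZ₁⟩ := ihj
        obtain ⟨Z₂, hrep₂, hZ₂⟩ := ih hrep
        have hs : (γ.aut.arena γ.k).solve .O N cs Z₁ = f^[j + 1] {_v | Good .O i} := by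
          rw [Function.iterate_succ_apply']
          refine solve_congr fun c hc => ?_
          by_cases hci : c = i
          · subst hci; rw [hi, Function.update_self]
          · rw [Function.update_of_ne hci, hZ₁ c (by simp [hc, hci])]
        rw [hs] at hrep₂
        refine ⟨Function.update Z₂ i (f^[j + 1] {_v | Good .O i}), _, ?_, fun _ => rfl,
          Function.update_self .., fun c hc => ?_⟩
        · rw [Function.iterate_succ_apply']
          have := hrep₂.assign i
          simpa only [hbody, List.foldl_append, List.foldl_cons, List.foldl_nil] using this
        · have hc' := hc
          simp only [List.mem_cons, not_or] at hc
          rw [Function.update_of_ne hc.1, hZ₂ c hc.2, hZ₁ c hc']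
    obtain ⟨Z', X', hrep, hX', -, hZ'⟩ := loop N
    obtain rfl := hX' (by simp [hN, vertexList])
    refine ⟨Z', ?_, hZ'⟩
    have : γ.instrs (i :: cs) = ((true, true), i) :: γ.vertexList.flatMap fun _ =>
      γ.instrs cs ++ [((true, false), i)] := rfl
    rw [this, List.foldl_cons, foldl_flatMap_const]
    exact hrep

variable (γ)

/-- The initial sets do not matter, since every color is reset before use. -/
theorem winnerIsO_iff : γ.winnerIsO = true ↔
    .start ∈ (γ.aut.arena γ.k).solve .O γ.vertexList.length γ.colors fun _ => ∅ := by
  have h : γ.Represents ([], []) (fun _ => ∅) ∅ := ⟨by simp, by simp⟩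
  obtain ⟨Z', hrep, _⟩ := h.foldl_instrs γ.colors
  rw [← hrep.2, winnerIsO, winRegion, List.any_eq_true]
  simp only [beq_iff_eq, exists_eq_right]
  rfl

/-! ### The output -/

theorem exists_vertices : ∃ l : List (γ.aut.Vertex γ.k), l.map γ.vertexCode = γ.vertexList := by
  have : ∀ c ∈ γ.vertexList, c ∈ Set.range γ.vertexCode := fun c hc => (γ.mem_vertexList c).1 hc
  generalize γ.vertexList = L at this
  induction L with
  | nil => exact ⟨[], rfl⟩
  | cons c L ih =>
    obtain ⟨l, hl⟩ := ih fun c hc => this c (List.mem_cons_of_mem _ hc)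
    obtain ⟨v, hv⟩ := this c List.mem_cons_self
    exact ⟨v :: l, by rw [List.map_cons, hv, hl]⟩

theorem _root_.DelayGame.encodeList_map {β δ : Type*} (g : β → δ) (f : δ → Tree) (l : List β) :
    encodeList f (l.map g) = encodeList (fun x => f (g x)) l := by
  induction l with
  | nil => rfl
  | cons x l ih => simp [encodeList, ih]

theorem _root_.DelayGame.ofFn_get {β δ : Type*} (l : List β) (g : β → δ) :
    (List.ofFn fun i => g (l.get i)) = l.map g := by
  apply List.ext_getElem <;> simp

-- Vertices are numbered by their place in `vertexList`, which is exhaustive and free of duplicates,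
-- so the computed tables are those of the arena transported to `Fin N`.
open Classical in
theorem exists_game : ∃ (N : ℕ) (G : ParityGame (Fin N)) (e : Fin N ≃ γ.aut.Vertex γ.k),
    N = γ.vertexList.length ∧ G.IsIso (γ.aut.arena γ.k) e ∧
    encodeOutput G (if γ.winnerIsO then .O else .I) = enc γ.output := by
  obtain ⟨l, hl⟩ := γ.exists_vertices
  have hnd : l.Nodup := List.Nodup.of_map γ.vertexCode (hl ▸ γ.vertexList_nodup)
  have hmem : ∀ v, v ∈ l := fun v => by
    have : γ.vertexCode v ∈ l.map γ.vertexCode := hl ▸ (γ.mem_vertexList _).2 ⟨v, rfl⟩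
    obtain ⟨v', hv', h⟩ := List.mem_map.1 this
    exact γ.vertexCode_injective h ▸ hv'
  set e := hnd.getEquivOfForallMemList l hmem with he
  have hget : ∀ i, e i = l.get i := fun _ => rfl
  set A := γ.aut.arena γ.k with hA
  refine ⟨l.length, ⟨fun i => A.owner (e i), fun i j => A.edge (e i) (e j), e.symm A.init,
    fun i => A.color (e i)⟩, e, by rw [← hl, List.length_map], ⟨fun _ => rfl, fun _ _ => Iff.rfl,
    e.apply_symm_apply _, fun _ => rfl⟩, ?_⟩
  -- The code of the initial vertex is the head of `vertexList`.
  have h0 : ((e.symm A.init : Fin l.length) : ℕ) = 0 := by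
    cases l with
    | nil => exact absurd (hmem .start) (by simp)
    | cons v l =>
      have : A.init = e ⟨0, by simp⟩ := by
        have h1 : γ.vertexCode v = γ.vertexCode .start := by
          rw [vertexList, List.map_cons] at hl
          exact (List.cons.inj hl).1
        rw [hget]
        exact (γ.vertexCode_injective h1).symm
      rw [this, Equiv.symm_apply_apply]
  have hbool : ∀ b : Bool, encodePlayer (if b then .O else .I) = encodeBool b := fun b => by
    cases b <;> rfl
  have howner : encodeList encodePlayer (List.ofFn fun i => A.owner (e i)) =
      enc (γ.vertexList.map fun v => v.1.1) := by
    simp only [hget]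
    rw [ofFn_get l A.owner, ← hl, List.map_map, encodeList_map]
    change _ = encodeList encodeBool _
    rw [encodeList_map]
    congr 1
    funext v
    cases v <;> rfl
  have hcolor : encodeList encodeNat (List.ofFn fun i => A.color (e i)) =
      enc (γ.vertexList.map γ.vertexColor) := by
    simp only [hget]
    rw [ofFn_get l A.color, ← hl, List.map_map]
    simp only [Function.comp_def, vertexColor_vertexCode]
    rfl
  have hedge : encodeList (encodeList encodeBool) (List.ofFn fun i => List.ofFn fun j =>
      decide (A.edge (e i) (e j))) =
      enc (γ.vertexList.map fun v => γ.vertexList.map fun v' => γ.edge v v') := by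
    simp only [hget]
    have h1 : ∀ v, (List.ofFn fun j => decide (A.edge v (l.get j))) =
        γ.vertexList.map fun v' => γ.edge (γ.vertexCode v) v' := fun v => by
      rw [ofFn_get l fun v' => decide (A.edge v v'), ← hl, List.map_map]
      refine List.map_congr_left fun v' _ => ?_
      rw [Bool.eq_iff_iff, decide_eq_true_eq]
      exact (γ.edge_vertexCode v v').symm
    simp only [h1]
    rw [ofFn_get l fun v => γ.vertexList.map fun v' => γ.edge (γ.vertexCode v) v']
    have h2 : γ.vertexList.map (fun v => γ.vertexList.map fun v' => γ.edge v v') =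
        l.map fun v => γ.vertexList.map fun v' => γ.edge (γ.vertexCode v) v' := by
      conv_lhs => rw [← hl, List.map_map]
      rw [hl]; rfl
    rw [h2]
    rfl
  simp only [encodeOutput, encodeGame, hbool, h0, howner, hcolor, hedge]
  rfl

/-- The algorithm computes the winner. -/
theorem winner_correct {N : ℕ} {G : ParityGame (Fin N)} {e : Fin N ≃ γ.aut.Vertex γ.k}
    (hN : N = γ.vertexList.length) (he : G.IsIso (γ.aut.arena γ.k) e) (p : Player) :
    (G.Wins p ↔ p = if γ.winnerIsO then .O else .I) ∧ (γ.aut.OWins γ.k ↔ γ.winnerIsO = true) := by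
  have : Fintype (γ.aut.Vertex γ.k) := Fintype.ofEquiv _ e
  have hcard : Fintype.card (γ.aut.Vertex γ.k) ≤ γ.vertexList.length := by
    rw [← hN, ← Fintype.card_congr e, Fintype.card_fin]
  have hpos := fun p => exists_posWins (G := γ.aut.arena γ.k) p hcard γ.colors_pairwise
    γ.color_mem_colors
  have hinit : e G.init = .start := he.init
  cases hw : γ.winnerIsO
  · have hs : .start ∈ ((γ.aut.arena γ.k).solve .O γ.vertexList.length γ.colors fun _ => ∅)ᶜ :=
      fun h => by rw [γ.winnerIsO_iff.2 h] at hw; simp at hw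
    -- What is not won by Player `O` is the nested fixed point of Player `I`, from which there is a
    -- positional strategy.
    rw [compl_solve] at hs
    obtain ⟨g, hg⟩ := hpos .I _
    have hI : G.Wins .I := (hg.comap he).wins (by rw [Set.mem_preimage, hinit]; exact hs)
    refine ⟨?_, iff_of_false (DPA.not_oWins_of_posWins hg hs) (by simp)⟩
    cases p with
    | I => simpa using hI
    | O => simpa using fun hO => Wins.unique hO hI
  · have hs := γ.winnerIsO_iff.1 hw
    obtain ⟨g, hg⟩ := hpos .O _
    have hO : G.Wins .O := (hg.comap he).wins (by rw [Set.mem_preimage, hinit]; exact hs)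
    refine ⟨?_, iff_of_true (DPA.oWins_of_posWins hg hs) rfl⟩
    cases p with
    | O => simpa using hO
    | I => simpa using fun hI => Wins.unique hO hI

end Input

end DelayGame

/-! ### The main theorem. -/

theorem lemma3p3 :
    ∃ (P : DelayGame.Program) (d : ℕ),
      ∀ (n s t k : ℕ) (𝔄 : DelayGame.DPA (Fin n) (Fin s × Fin t)),
        0 < s → 0 < t → 0 < k → k ≤ 2 ^ (n ^ 2 * 𝔄.numColors + 1) →
        ∃ (N : ℕ) (G : DelayGame.ParityGame (Fin N)) (e : Fin N ≃ 𝔄.Vertex k)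
          (p : DelayGame.Player) (T : ℕ),
          P.Outputs (DelayGame.encodeInput 𝔄 k) (DelayGame.encodeOutput G p) T ∧
          T ≤ 2 ^ (d * n ^ d) * (DelayGame.encodeInput 𝔄 k).size ^ d ∧
          G.IsIso (𝔄.arena k) e ∧
          N ≤ 2 ^ (d * n ^ d) ∧
          (∀ p', G.Wins p' ↔ p' = p) ∧
          (𝔄.OWins k ↔ p = DelayGame.Player.O) := by
  obtain ⟨P, b, c, h⟩ := DelayGame.Input.poly_output
  -- The expression for the output becomes function `0`, and all others move up by one. The constant
  -- `3 * c + 5` covers the running time `2 ^ (3 * c * n ^ 4) * ℓ ^ c` as well as the number `2 ^ (5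
  -- * n ^ 3)` of vertices.
  refine ⟨b.shift 1 :: P.map (DelayGame.Expr.shift 1), 3 * c + 5,
    fun n s t k 𝔄 hs ht hk hle => ?_⟩
  set γ : DelayGame.Input := ⟨n, s, t, k, 𝔄, hs, ht, hk, hle⟩ with hγ
  obtain ⟨N, G, e, hN, he, henc⟩ := γ.exists_game
  obtain ⟨T, hT, hev⟩ := (h γ).2
  have hn : 0 < n := γ.n_pos
  have hpow : ∀ m i, m ≤ 3 * c + 5 → i ≤ 3 * c + 5 →
      m * n ^ i ≤ (3 * c + 5) * n ^ (3 * c + 5) := fun m i hm hi =>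
    Nat.mul_le_mul hm (Nat.pow_le_pow_right hn hi)
  refine ⟨N, G, e, _, T, ⟨b.shift 1, rfl, ?_⟩, ?_, he, ?_,
    fun p' => (γ.winner_correct hN he p').1, ?_⟩
  · rw [henc]
    exact hev.shift fun i b hb => by simp [hb]
  · set ℓ := (DelayGame.encodeInput 𝔄 k).size with hℓ
    have hℓ1 : 1 ≤ ℓ := DelayGame.Tree.one_le_size _
    -- Bounding the sum by a product separates the dependence on `n` from that on the length of the
    -- input.
    have hw : DelayGame.Enc.wt γ ≤ 2 ^ (3 * n ^ 4) * ℓ := by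
      change ℓ + 1 + 2 ^ n ^ 4 ≤ _
      have h1 : 1 ≤ n ^ 4 := Nat.one_le_pow _ _ hn
      have h2 : 2 ≤ 2 ^ n ^ 4 := by
        calc 2 = 2 ^ 1 := rfl
          _ ≤ _ := Nat.pow_le_pow_right (by norm_num) h1
      calc ℓ + 1 + 2 ^ n ^ 4 ≤ 2 * 2 * 2 ^ n ^ 4 * ℓ := by nlinarith
        _ ≤ 2 ^ n ^ 4 * 2 ^ n ^ 4 * 2 ^ n ^ 4 * ℓ := by gcongr
        _ = 2 ^ (3 * n ^ 4) * ℓ := by rw [← pow_add, ← pow_add]; ring_nf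
    by_cases hc : c = 0
    · subst hc
      refine hT.trans ?_
      rw [pow_zero]
      exact Nat.mul_pos (by positivity) (by positivity)
    calc T ≤ (2 ^ (3 * n ^ 4) * ℓ) ^ c := hT.trans (Nat.pow_le_pow_left hw c)
      _ = 2 ^ (3 * c * n ^ 4) * ℓ ^ c := by rw [mul_pow, ← pow_mul]; ring_nf
      _ ≤ _ := Nat.mul_le_mul
        (Nat.pow_le_pow_right (by norm_num) (hpow _ _ (by omega) (by omega)))
        (Nat.pow_le_pow_right hℓ1 (by omega))
  · rw [hN]
    exact γ.length_vertexList_le.trans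
      (Nat.pow_le_pow_right (by norm_num) (hpow _ _ (by omega) (by omega)))
  · refine (γ.winner_correct hN he .O).2.trans ?_
    cases γ.winnerIsO <;> simp
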